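/- Let $d\in\mathbb N$, let $Y_1,\dots,Y_d$ be a basis of $\mathbb R^d$ generating the lattice $\mathcal R=\{\sum_j n_jY_j: n_j\in\mathbb Z\}$, and let $\mathcal V\subset\mathbb R^d$ be a unit cell, i.e. the $\mathcal R$-translates of $\mathcal V$ cover $\mathbb R^d$ without overlapping, up to null sets. Write $\langle f\rangle=|\mathcal V|^{-1}\int_{\mathcal V}f\,dx$ and $s:e=\sum_{i,j}s_{ij}e_{ij}$. Let $L_0$ be a constant positive definite fourth-order tensor with major and minor symmetries, and let $L$ be a measurable field on $\mathcal V$ of fourth-order tensors with major and minor symmetries, with components in $L^\infty(\mathcal V)$, and uniformly positive definite: for some $\alpha>0$, $L(x)e:e\ge\alpha\, e:e$ for a.e. $x\in\mathcal V$ and all symmetric $e$. Inverses are taken on symmetric second-order tensors. Let $\mathcal H_e$ and $\mathcal H_s$ both be the space of $\mathcal R$-periodic, locally square-integrable fields of symmetric $d\times d$ tensors, with the scalar products $(\eta,\eta')_{\mathcal H_e}=\langle L_0\eta:\eta'\rangle$ and $(\tau,\tau')_{\mathcal H_s}=\langle\tau:L_0^{-1}\tau'\rangle$. Let $\mathcal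 E_0\subset\mathcal H_e$ be the set of fields $\tfrac12(\nabla w+\nabla w^{\top})$ with $w$ an $\mathcal R$-periodic vector field in $H^1_{\mathrm{loc}}(\mathbb R^d)$. Let $\mathcal S_0\subset\mathcal H_s$ be the set of fields $s$ with $\langle s\rangle=0$ that are divergence-free with anti-periodic tractions in the weak sense, i.e. $\int_{\mathcal V}\sum_j s_{ij}\,\partial_j\varphi\,dx=0$ for all $i$ and all smooth $\mathcal R$-periodic $\varphi$. Let $\mathcal S=\mathcal U_s\oplus\mathcal S_0$, where $\mathcal U_s$ is the space of uniform fields. Let $P_{\mathcal E_0}$ be the orthogonal projection in $\mathcal H_e$ onto $\mathcal E_0$, and let $P_{\mathcal S_0}$, $P_{\mathcal S^\perp}$ be the orthogonal projections in $\mathcal H_s$ onto $\mathcal S_0$ and onto the orthogonal complement of $\mathcal S$. For $(\tau,\eta)\in\mathcal H_s\times\mathcal H_e$ put $$\tau_{\mathcal S}=\langle\tau\rangle+P_{\mathcal S_0}\tau,\qquad \eta_{\mathcal E_0}=P_{\mathcal E_0}\eta .$$ For a prescribed constant symmetric tensor $\bar\varepsilon$ (the macroscopic strain), let $$\mathcal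 J(e)=\tfrac12\langle L(\bar\varepsilon+e):(\bar\varepsilon+e)\rangle,\qquad \mathcal J_c(s)=\tfrac12\langle s:L^{-1}s\rangle-\langle s\rangle:\bar\varepsilon,$$ $$\mathcal P(\tau,\eta)=\tfrac12\|\eta-P_{\mathcal E_0}\eta-\bar\varepsilon\|_{\mathcal H_e}^2+\big\langle \tfrac12 L\eta:\eta+\tfrac12\,\tau:L^{-1}\tau-\tau:\eta\big\rangle+\tfrac12\|P_{\mathcal S^\perp}\tau\|_{\mathcal H_s}^2 .$$ **Proposition.** The projections $P_{\mathcal E_0}\eta$ and $P_{\mathcal S^\perp}\tau$ exist, and $\tau_{\mathcal S}$ and $\eta_{\mathcal E_0}$ are the orthogonal projections of $\tau$ onto $\mathcal S$ in $\mathcal H_s$ and of $\eta$ onto $\mathcal E_0$ in $\mathcal H_e$ (the statically and kinematically admissible components). There is a constant $c>0$, depending only on the field $L$ (given on $\mathcal V$) and on $L_0$ — in particular not on $\bar\varepsilon$ — such that for all $(\tau,\eta)\in\mathcal H_s\times\mathcal H_e$ $$0\le\mathcal J_c(\tau_{\mathcal S})+\mathcal J(\eta_{\mathcal E_0})\le c\,\mathcal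 P(\tau,\eta).$$ -/

import Mathlib

open MeasureTheory
open scoped ContDiff

namespace PeriodicElasticity

noncomputable section

/-- The physical space `ℝ^d` with its Euclidean norm. -/
abbrev Space (d : ℕ) : Type := EuclideanSpace ℝ (Fin d)

/-- Symmetric second-order tensors, as a subspace of the `d × d` arrays. The inherited inner product
is the doubly contracted product `s : e = ∑ i j, s i j * e i j`. -/
def symTensors (d : ℕ) : Submodule ℝ (EuclideanSpace ℝ (Fin d × Fin d)) where
  carrier := {e | ∀ i j, e (i, j) = e (j, i)}
  add_mem' := by
    intro a b ha hb i j
    simp [ha i j, hb i j]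
  zero_mem' := by
    intro i j
    simp
  smul_mem' := by
    intro c a ha i j
    simp [ha i j]

/-- The space of symmetric second-order tensors. -/
abbrev SymTensor (d : ℕ) : Type := symTensors d

/-- Fourth-order tensors with minor symmetries, i.e. linear maps on symmetric second-order tensors,
`(A e) i j = ∑ k l, A i j k l * e k l`. -/
abbrev Tensor4 (d : ℕ) : Type := SymTensor d →L[ℝ] SymTensor d

/-- Fields of symmetric second-order tensors on `ℝ^d`. -/
abbrev TensorField (d : ℕ) : Type := Space d → SymTensor d

variable {d : ℕ}

/-- A uniform elasticity tensor: a positive definite fourth-order tensor with minor symmetries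
(built into `Tensor4`) and major symmetry (self-adjointness for the product `s : e`). -/
structure IsElasticityTensor (A : Tensor4 d) : Prop where
  major_symm : ∀ e f : SymTensor d, inner ℝ (A e) f = inner ℝ e (A f)
  pos_def : ∀ e : SymTensor d, e ≠ 0 → 0 < inner ℝ (A e) e

/-- The elasticity tensor field of a composite occupying the cell `V`: measurable, essentially
bounded, with major and minor symmetries, and uniformly positive definite. Only the values in `V`
matter. -/
structure IsElasticityField (V : Set (Space d)) (L : Space d → Tensor4 d) : Prop where
  aestronglyMeasurable : AEStronglyMeasurable L (volume.restrict V)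
  bounded : ∃ M : ℝ, ∀ᵐ x ∂volume.restrict V, ‖L x‖ ≤ M
  major_symm : ∀ᵐ x ∂volume.restrict V, ∀ e f : SymTensor d, inner ℝ (L x e) f = inner ℝ e (L x f)
  coercive : ∃ α : ℝ, 0 < α ∧
    ∀ᵐ x ∂volume.restrict V, ∀ e : SymTensor d, α * ‖e‖ ^ 2 ≤ inner ℝ (L x e) e

/-- The lattice `{∑ j, n j • Y j | n j ∈ ℤ}` generated by the vectors `Y j`. -/
abbrev lattice (Y : Module.Basis (Fin d) ℝ (Space d)) : Submodule ℤ (Space d) :=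
  Submodule.span ℤ (Set.range Y)

/-- `V` is a unit cell: its translates by the lattice fill the space (up to null sets) without
overlapping. -/
def IsUnitCell (Y : Module.Basis (Fin d) ℝ (Space d)) (V : Set (Space d)) : Prop :=
  IsAddFundamentalDomain (lattice Y) V (volume : Measure (Space d))

/-- Square integrable periodic functions `L²_per(V)`. Since a periodic function is determined by
its restriction to the cell, local square integrability is square integrability on `V`. -/
def L2per {F : Type*} [NormedAddCommGroup F] (Y : Module.Basis (Fin d) ℝ (Space d))
    (V : Set (Space d)) : Set (Space d → F) :=
  {f | MemLp f 2 (volume.restrict V) ∧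
    ∀ y ∈ lattice Y, ∀ᵐ x ∂(volume : Measure (Space d)), f (x + y) = f x}

/-- Smooth periodic test functions. -/
def IsTest (Y : Module.Basis (Fin d) ℝ (Space d)) (φ : Space d → ℝ) : Prop :=
  ContDiff ℝ ∞ φ ∧ ∀ y ∈ lattice Y, ∀ x, φ (x + y) = φ x

/-- The partial derivative of a smooth function in the `j`-th coordinate direction. -/
def pderiv (j : Fin d) (φ : Space d → ℝ) (x : Space d) : ℝ :=
  fderiv ℝ φ x (EuclideanSpace.single j 1)

/-- `g` is the weak partial derivative `∂_j f` of the periodic function `f`. -/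
def HasWeakPDeriv (Y : Module.Basis (Fin d) ℝ (Space d)) (V : Set (Space d)) (j : Fin d)
    (f g : Space d → ℝ) : Prop :=
  ∀ φ : Space d → ℝ, IsTest Y φ →
    ∫ x in V, f x * pderiv j φ x = - ∫ x in V, g x * φ x

/-- The vector field `w` lies in `H¹_per(V)`, with weak gradient `G i j = ∂_j (w i)`. -/
def IsH1perWithGradient (Y : Module.Basis (Fin d) ℝ (Space d)) (V : Set (Space d))
    (w : Fin d → Space d → ℝ) (G : Fin d → Fin d → Space d → ℝ) : Prop :=
  (∀ i, w i ∈ L2per Y V) ∧ ∀ i j, G i j ∈ L2per Y V ∧ HasWeakPDeriv Y V j (w i) (G i j)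

/-- Square integrable periodic fields of symmetric tensors: the underlying set of both the strain
space `H_e` and the stress space `H_s`, which differ by their scalar products. -/
def tensorFields (Y : Module.Basis (Fin d) ℝ (Space d)) (V : Set (Space d)) :
    Set (TensorField d) :=
  L2per Y V

/-- `E_0`: the strain fields `(∇w + ∇wᵀ) / 2` that derive from a periodic displacement field `w`. -/
def compatibleFields (Y : Module.Basis (Fin d) ℝ (Space d)) (V : Set (Space d)) :
    Set (TensorField d) :=
  {e | e ∈ tensorFields Y V ∧ ∃ w G, IsH1perWithGradient Y V w G ∧
    ∀ i j, ∀ᵐ x ∂(volume : Measure (Space d)),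
      (e x : EuclideanSpace ℝ (Fin d × Fin d)) (i, j) = (G i j x + G j i x) / 2}

/-- Uniform fields. -/
def uniformFields (Y : Module.Basis (Fin d) ℝ (Space d)) (V : Set (Space d)) :
    Set (TensorField d) :=
  {u | u ∈ tensorFields Y V ∧ ∃ m : SymTensor d, u =ᵐ[volume] fun _ => m}

/-- `S_0`: the mean-free stress fields that are divergence-free, with anti-periodic tractions on the
boundary of the cell. As usual the last two conditions are understood in the weak sense, i.e.
`∫_V ∑ j, s i j * ∂_j φ = 0` for each row `i` and each smooth periodic `φ`. -/
def selfEquilibratedFields (Y : Module.Basis (Fin d) ℝ (Space d)) (V : Set (Space d)) :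
    Set (TensorField d) :=
  {s | s ∈ tensorFields Y V ∧
    (∀ i : Fin d, ∀ φ : Space d → ℝ, IsTest Y φ →
      ∫ x in V, ∑ j, (s x : EuclideanSpace ℝ (Fin d × Fin d)) (i, j) * pderiv j φ x = 0) ∧
    ⨍ x in V, s x = 0}

/-- `S = U_s ⊕ S_0`: the statically admissible stress fields. -/
def equilibratedFields (Y : Module.Basis (Fin d) ℝ (Space d)) (V : Set (Space d)) :
    Set (TensorField d) :=
  {s | ∃ u ∈ uniformFields Y V, ∃ s₀ ∈ selfEquilibratedFields Y V, s = u + s₀}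

/-- The energetic scalar product `⟨L₀ η : η'⟩` of the strain space `H_e`. -/
def strainProd (V : Set (Space d)) (L₀ : Tensor4 d) (η η' : TensorField d) : ℝ :=
  ⨍ x in V, inner ℝ (L₀ (η x)) (η' x)

/-- The energetic scalar product `⟨τ : L₀⁻¹ τ'⟩` of the stress space `H_s`. -/
def stressProd (V : Set (Space d)) (L₀ : Tensor4 d) (τ τ' : TensorField d) : ℝ :=
  ⨍ x in V, inner ℝ (τ x) (L₀.inverse (τ' x))

/-- `p` is (a representative of) the orthogonal projection of `f` onto `K` for the scalar
product `B`. -/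
def IsOrthProj (B : TensorField d → TensorField d → ℝ) (K : Set (TensorField d))
    (f p : TensorField d) : Prop :=
  p ∈ K ∧ ∀ k ∈ K, B (f - p) k = 0

/-- The orthogonal projection of `f` onto `K` for the scalar product `B` (an arbitrary field if
there is none). -/
def orthProj (B : TensorField d → TensorField d → ℝ) (K : Set (TensorField d))
    (f : TensorField d) : TensorField d :=
  Classical.epsilon (IsOrthProj B K f)

/-- `S^⊥`: the orthogonal complement of `S` in `H_s`. -/
def equilibratedOrtho (Y : Module.Basis (Fin d) ℝ (Space d)) (V : Set (Space d))
    (L₀ : Tensor4 d) : Set (TensorField d) :=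
  {τ | τ ∈ tensorFields Y V ∧ ∀ s ∈ equilibratedFields Y V, stressProd V L₀ τ s = 0}

/-- The kinematically admissible component `η_{E_0} = P_{E_0} η`. -/
def kinComponent (Y : Module.Basis (Fin d) ℝ (Space d)) (V : Set (Space d)) (L₀ : Tensor4 d)
    (η : TensorField d) : TensorField d :=
  orthProj (strainProd V L₀) (compatibleFields Y V) η

/-- The statically admissible component `τ_S = ⟨τ⟩ + P_{S_0} τ`. -/
def statComponent (Y : Module.Basis (Fin d) ℝ (Space d)) (V : Set (Space d)) (L₀ : Tensor4 d)
    (τ : TensorField d) : TensorField d :=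
  (fun _ => ⨍ x in V, τ x) + orthProj (stressProd V L₀) (selfEquilibratedFields Y V) τ

/-- The component `τ_{S^⊥} = P_{S^⊥} τ`. -/
def statOrthoComponent (Y : Module.Basis (Fin d) ℝ (Space d)) (V : Set (Space d))
    (L₀ : Tensor4 d) (τ : TensorField d) : TensorField d :=
  orthProj (stressProd V L₀) (equilibratedOrtho Y V L₀) τ

/-- The strain energy `J(e) = ½ ⟨L (ε + e) : (ε + e)⟩` for the macroscopic strain `ε`. -/
def strainEnergy (V : Set (Space d)) (L : Space d → Tensor4 d) (ε : SymTensor d)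
    (e : TensorField d) : ℝ :=
  (1 / 2 : ℝ) * ⨍ x in V, inner ℝ (L x (ε + e x)) (ε + e x)

/-- The complementary energy `J_c(s) = ½ ⟨s : L⁻¹ s⟩ - ⟨s⟩ : ε`. -/
def complementaryEnergy (V : Set (Space d)) (L : Space d → Tensor4 d) (ε : SymTensor d)
    (s : TensorField d) : ℝ :=
  (1 / 2 : ℝ) * (⨍ x in V, inner ℝ (s x) ((L x).inverse (s x))) - inner ℝ (⨍ x in V, s x) ε

/-- The local error in constitutive relations
`r(x, τ, η) = ½ L η : η + ½ τ : L⁻¹ τ - τ : η`. -/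
def constitutiveError (L : Space d → Tensor4 d) (τ η : TensorField d) (x : Space d) : ℝ :=
  (1 / 2 : ℝ) * inner ℝ (L x (η x)) (η x) + (1 / 2 : ℝ) * inner ℝ (τ x) ((L x).inverse (τ x))
    - inner ℝ (τ x) (η x)

/-- The error in kinematic admissibility `½ ‖(I - P_{E_0}) η - ε‖²` in `H_e`. -/
def compatError (Y : Module.Basis (Fin d) ℝ (Space d)) (V : Set (Space d)) (L₀ : Tensor4 d)
    (ε : SymTensor d) (η : TensorField d) : ℝ :=
  (1 / 2 : ℝ) * strainProd V L₀ (η - kinComponent Y V L₀ η - fun _ => ε)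
    (η - kinComponent Y V L₀ η - fun _ => ε)

/-- The error in static admissibility `½ ‖P_{S^⊥} τ‖²` in `H_s`. -/
def equilError (Y : Module.Basis (Fin d) ℝ (Space d)) (V : Set (Space d)) (L₀ : Tensor4 d)
    (τ : TensorField d) : ℝ :=
  (1 / 2 : ℝ) * stressProd V L₀ (statOrthoComponent Y V L₀ τ) (statOrthoComponent Y V L₀ τ)

/-- The geometric functional `P(τ, η)`. -/
def geometricFunctional (Y : Module.Basis (Fin d) ℝ (Space d)) (V : Set (Space d))
    (L : Space d → Tensor4 d) (L₀ : Tensor4 d) (ε : SymTensor d) (τ η : TensorField d) : ℝ :=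
  compatError Y V L₀ ε η + (⨍ x in V, constitutiveError L τ η x) + equilError Y V L₀ τ

end

end PeriodicElasticity

namespace PeriodicElasticity

open scoped Pointwise InnerProductSpace ComplexConjugate

noncomputable section

variable {d : ℕ}

/-! The core is an identity for admissible fields. If `s` lies in `S` and `e` in `E_0`, then the
average of `s : e` vanishes, so the sum of the two energies is exactly the average of the
constitutive error `r` of the pair `s`, `ε + e` (`complementaryEnergy_add_strainEnergy`). Completing
the square gives `r(τ, η) = ½ (τ - Lη) : L⁻¹ (τ - Lη)`, which is nonnegative; this is the lower
bound.

For the upper bound, put `b = τ - τ_S` and `g = η - η_{E_0} - ε`. The residual of the projected pair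
is `(τ - Lη) - b + Lg`. A three-term inequality for the form of `L⁻¹` (`constitutiveError_sub_le`),
with the bounds on `L` and `L⁻¹`, controls its error by the constitutive error of `(τ, η)` and the
`L²` norms of `b` and `g`. Coercivity of `L₀` and `L₀⁻¹` turns these norms into the energetic ones,
which are the two remaining terms of `P`. Neither `ε` nor the lattice enters the constant.

Existence of the projections needs closed subspaces of `L²` (`exists_isOrthProj`). The space `S_0`
is an intersection of kernels of continuous functionals. The space `E_0` is the image of the closed
space of mean-free displacements with their gradients under the strain map, which is bounded below
there by the inequalities of Korn and Poincaré. The projection onto `S` is then the mean plus the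
projection onto `S_0`, and the projection onto `S^⊥` is what remains.

The cell is only a measurable fundamental domain, possibly unbounded and without a regular boundary,
so integration by parts on `V` is replaced by Fourier series. Poincaré, Korn and the orthogonality
of `S_0` to `E_0` are all checked one frequency at a time with Parseval's identity (`hasSum_coeff`).
-/

/-- The uniform probability measure on the cell `V`; integrals against it are averages over `V`. -/
def cellMeasure (V : Set (Space d)) : Measure (Space d) :=
  ((volume.restrict V) Set.univ)⁻¹ • volume.restrict V

lemma setAverage_eq_integral_cellMeasure {E : Type*} [NormedAddCommGroup E] [NormedSpace ℝ E]
    (V : Set (Space d)) (f : Space d → E) : ⨍ x in V, f x = ∫ x, f x ∂cellMeasure V := rfl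

instance (Y : Module.Basis (Fin d) ℝ (Space d)) :
    VAddInvariantMeasure (lattice Y) (Space d) (volume : Measure (Space d)) :=
  ⟨fun y _ _ => measure_preimage_add volume (y : Space d) _⟩

/-! ### Null sets and averages on the unit cell, periodic extension -/

namespace IsUnitCell

variable {Y : Module.Basis (Fin d) ℝ (Space d)} {V : Set (Space d)}

lemma volume_ne_zero (hV : IsUnitCell Y V) : volume V ≠ 0 :=
  IsAddFundamentalDomain.measure_ne_zero (NeZero.ne _) hV

/-- The cell may be unbounded, but all fundamental domains of the lattice have the same volume, and
the parallelepiped spanned by the basis is bounded. -/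
lemma volume_ne_top (hV : IsUnitCell Y V) : volume V ≠ ⊤ := by
  have h := IsAddFundamentalDomain.measure_eq hV (ZSpan.isAddFundamentalDomain Y volume)
  rw [h]
  exact (ZSpan.fundamentalDomain_isBounded Y).measure_lt_top.ne

lemma ae_cellMeasure_iff (hV : IsUnitCell Y V) {p : Space d → Prop} :
    (∀ᵐ x ∂cellMeasure V, p x) ↔ ∀ᵐ x ∂volume.restrict V, p x := by
  unfold cellMeasure
  rw [Measure.ae_ennreal_smul_measure_iff]
  simp [hV.volume_ne_top]

lemma isProbabilityMeasure (hV : IsUnitCell Y V) : IsProbabilityMeasure (cellMeasure V) := by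
  constructor
  simp only [cellMeasure, Measure.smul_apply, Measure.restrict_apply_univ, smul_eq_mul]
  exact ENNReal.inv_mul_cancel hV.volume_ne_zero hV.volume_ne_top

lemma memLp_iff (hV : IsUnitCell Y V) {E : Type*} [NormedAddCommGroup E] {f : Space d → E} :
    MemLp f 2 (cellMeasure V) ↔ MemLp f 2 (volume.restrict V) := by
  unfold cellMeasure
  have h0 : ((volume.restrict V) Set.univ) ≠ 0 := by simpa using hV.volume_ne_zero
  have h1 : ((volume.restrict V) Set.univ) ≠ ⊤ := by simpa using hV.volume_ne_top
  refine ⟨fun h => h.of_measure_le_smul h1 ?_, fun h => h.smul_measure (by simpa using h0)⟩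
  rw [smul_smul, ENNReal.mul_inv_cancel h0 h1, one_smul]

lemma setIntegral_eq_smul (hV : IsUnitCell Y V) {E : Type*} [NormedAddCommGroup E]
    [NormedSpace ℝ E] (f : Space d → E) :
    ∫ x in V, f x = (volume V).toReal • ∫ x, f x ∂cellMeasure V := by
  simp only [cellMeasure, integral_smul_measure, Measure.restrict_apply_univ, smul_smul,
    ENNReal.toReal_inv]
  rw [mul_inv_cancel₀, one_smul]
  exact ENNReal.toReal_ne_zero.2 ⟨hV.volume_ne_zero, hV.volume_ne_top⟩

lemma volume_toReal_ne_zero (hV : IsUnitCell Y V) : (volume V).toReal ≠ 0 :=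
  ENNReal.toReal_ne_zero.2 ⟨hV.volume_ne_zero, hV.volume_ne_top⟩

/-- A property that holds almost everywhere in the cell holds, for almost every point of the
space, at some lattice translate of that point. -/
lemma ae_exists_translate (hV : IsUnitCell Y V) {p : Space d → Prop}
    (hp : ∀ᵐ x ∂cellMeasure V, p x) : ∀ᵐ x : Space d, ∃ y ∈ lattice Y, p (x + y) := by
  rw [hV.ae_cellMeasure_iff, ae_restrict_iff'₀ hV.nullMeasurableSet] at hp
  have h2 : ∀ᵐ x : Space d, ∀ y : lattice Y, (x + (y : Space d)) ∈ V → p (x + y) := by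
    rw [ae_all_iff]
    intro y
    exact (measurePreserving_add_right volume (y : Space d)).quasiMeasurePreserving.ae hp
  filter_upwards [h2, hV.ae_covers] with x hx ⟨y, hy⟩
  refine ⟨y, y.2, hx y ?_⟩
  rwa [Submodule.vadd_def, vadd_eq_add, add_comm] at hy

/-- Almost every point has a translate in the cell at which the two functions agree; since the
lattice is countable, both periodicity relations hold there for all translations at once. -/
lemma ae_eq_of_ae_eq_cellMeasure (hV : IsUnitCell Y V) {E : Type*} {f g : Space d → E}
    (hf : ∀ y ∈ lattice Y, ∀ᵐ x : Space d, f (x + y) = f x)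
    (hg : ∀ y ∈ lattice Y, ∀ᵐ x : Space d, g (x + y) = g x)
    (h : f =ᵐ[cellMeasure V] g) : f =ᵐ[volume] g := by
  have hf' : ∀ᵐ x : Space d, ∀ y : lattice Y, f (x + (y : Space d)) = f x :=
    ae_all_iff.2 fun y => hf y y.2
  have hg' : ∀ᵐ x : Space d, ∀ y : lattice Y, g (x + (y : Space d)) = g x :=
    ae_all_iff.2 fun y => hg y y.2
  filter_upwards [hf', hg', hV.ae_exists_translate h] with x hfx hgx ⟨y, hy, e⟩
  rw [← hfx ⟨y, hy⟩, ← hgx ⟨y, hy⟩, e]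

end IsUnitCell

/-- The periodic extension of the restriction of `f` to the cell `V`. -/
def periodize {E : Type*} [AddCommMonoid E] [TopologicalSpace E]
    (Y : Module.Basis (Fin d) ℝ (Space d)) (V : Set (Space d))
    (f : Space d → E) (x : Space d) : E :=
  ∑' y : lattice Y, V.indicator f (x + y)

namespace IsUnitCell

variable {Y : Module.Basis (Fin d) ℝ (Space d)} {V : Set (Space d)}

lemma periodize_add {E : Type*} [AddCommMonoid E] [TopologicalSpace E] (f : Space d → E)
    {y : Space d} (hy : y ∈ lattice Y) (x : Space d) :
    periodize Y V f (x + y) = periodize Y V f x := by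
  unfold periodize
  rw [← (Equiv.addLeft (⟨y, hy⟩ : lattice Y)).tsum_eq (fun z => V.indicator f (x + z))]
  simp [add_assoc]

/-- Translates of the cell overlap only in null sets, so at almost every point of `V` only the zero
translation contributes to the sum. -/
lemma periodize_ae_eq (hV : IsUnitCell Y V) {E : Type*} [AddCommMonoid E] [TopologicalSpace E]
    (f : Space d → E) : periodize Y V f =ᵐ[cellMeasure V] f := by
  have h0 : ∀ᵐ x : Space d, x ∈ V → ∀ y : lattice Y, y ≠ 0 → x + (y : Space d) ∉ V := by
    have : ∀ᵐ x : Space d, ∀ y : lattice Y, y ≠ 0 → x ∈ V → x + (y : Space d) ∉ V := by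
      rw [ae_all_iff]
      intro y
      by_cases hy : y = 0
      · simp [hy]
      have h := hV.aedisjoint (show -y ≠ 0 by simpa using hy)
      have h' : volume ((-y +ᵥ V) ∩ V) = 0 := by
        simpa [Function.onFun, AEDisjoint] using h
      filter_upwards [measure_eq_zero_iff_ae_notMem.1 h'] with x hx _ hxV hxy
      refine hx ⟨?_, hxV⟩
      rw [Set.mem_vadd_set_iff_neg_vadd_mem]
      simpa [Submodule.vadd_def, add_comm] using hxy
    filter_upwards [this] with x hx hxV y hy using hx y hy hxV
  rw [Filter.EventuallyEq, hV.ae_cellMeasure_iff, ae_restrict_iff'₀ hV.nullMeasurableSet]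
  filter_upwards [h0] with x hx hxV
  unfold periodize
  rw [tsum_eq_single 0]
  · simp [hxV]
  · intro y hy
    simp [hx hxV y hy]

lemma exists_mem_L2per (hV : IsUnitCell Y V) {E : Type*} [NormedAddCommGroup E] {f : Space d → E}
    (hf : MemLp f 2 (cellMeasure V)) : ∃ g ∈ L2per Y V, g =ᵐ[cellMeasure V] f := by
  refine ⟨periodize Y V f, ⟨?_, fun y hy => ?_⟩, hV.periodize_ae_eq f⟩
  · rw [← hV.memLp_iff]
    exact hf.ae_eq (hV.periodize_ae_eq f).symm
  · exact Filter.Eventually.of_forall fun x => periodize_add f hy x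

end IsUnitCell

/-! ### Fourier series on the cell by transfer to the torus -/

section

/-- The projection of the space onto the torus, in the coordinates given by the lattice basis. -/
def torusMap (Y : Module.Basis (Fin d) ℝ (Space d)) (x : Space d) : UnitAddTorus (Fin d) :=
  fun i => ((Y.repr x i : ℝ) : UnitAddCircle)

/-- The phase `2π ∑ i, k i * y i` where `y` are the lattice coordinates of `x`. -/
def phase (Y : Module.Basis (Fin d) ℝ (Space d)) (k : Fin d → ℤ) : Space d →L[ℝ] ℝ :=
  LinearMap.toContinuousLinearMap (∑ i, (2 * Real.pi * k i) • Y.coord i)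

lemma phase_apply (Y : Module.Basis (Fin d) ℝ (Space d)) (k : Fin d → ℤ) (x : Space d) :
    phase Y k x = ∑ i, 2 * Real.pi * k i * Y.repr x i := by
  simp [phase]

lemma continuous_torusMap (Y : Module.Basis (Fin d) ℝ (Space d)) : Continuous (torusMap Y) := by
  refine continuous_pi fun i => ?_
  refine (AddCircle.continuous_mk' 1).comp ?_
  exact (Y.coord i).continuous_of_finiteDimensional

lemma mFourier_torusMap (Y : Module.Basis (Fin d) ℝ (Space d)) (k : Fin d → ℤ) (x : Space d) :
    UnitAddTorus.mFourier k (torusMap Y x) = Complex.exp (phase Y k x * Complex.I) := by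
  rw [phase_apply]
  simp only [UnitAddTorus.mFourier, torusMap, ContinuousMap.coe_mk, fourier_coe_apply]
  rw [← Complex.exp_sum]
  congr 1
  push_cast
  rw [Finset.sum_mul]
  refine Finset.sum_congr rfl fun i _ => ?_
  simp only [div_one]
  ring

lemma mem_lattice_iff (Y : Module.Basis (Fin d) ℝ (Space d)) (y : Space d) :
    y ∈ lattice Y ↔ ∀ i, ∃ n : ℤ, (n : ℝ) = Y.repr y i := by
  rw [Y.mem_span_iff_repr_mem ℤ y]
  simp

lemma torusMap_eq_iff (Y : Module.Basis (Fin d) ℝ (Space d)) (x x' : Space d) :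
    torusMap Y x = torusMap Y x' ↔ x - x' ∈ lattice Y := by
  rw [mem_lattice_iff, funext_iff]
  refine forall_congr' fun i => ?_
  unfold torusMap
  rw [← sub_eq_zero, ← AddCircle.coe_sub, AddCircle.coe_eq_zero_iff]
  simp

lemma torusMap_add (Y : Module.Basis (Fin d) ℝ (Space d)) {y : Space d} (hy : y ∈ lattice Y)
    (x : Space d) : torusMap Y (x + y) = torusMap Y x := by
  rw [torusMap_eq_iff]; simpa using hy

variable {Y : Module.Basis (Fin d) ℝ (Space d)} {V : Set (Space d)}

/-- Up to null sets, every measurable function on the cell factors through the torus. -/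
lemma IsUnitCell.exists_comp_torusMap (hV : IsUnitCell Y V) {f : Space d → ℂ}
    (hf : Measurable f) : ∃ g : UnitAddTorus (Fin d) → ℂ, Measurable g ∧
      f =ᵐ[cellMeasure V] g ∘ torusMap Y := by
  -- The fundamental interior drops the points of `V` that also lie in another translate, which
  -- makes `torusMap` injective; `W` is a Borel subset of it of full measure.
  obtain ⟨W, hWV, hW, hWe⟩ :=
    (hV.nullMeasurableSet.addFundamentalInterior (lattice Y)).exists_measurable_subset_ae_eq
  have hinj : Function.Injective (fun x : W => torusMap Y x) := by
    intro x x' h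
    have hl := (torusMap_eq_iff Y x x').1 h
    by_contra hne
    have hne' : (⟨x - x', hl⟩ : lattice Y) ≠ 0 := by
      intro h0
      exact hne (Subtype.ext (sub_eq_zero.1 (congrArg Subtype.val h0)))
    have h1 := (mem_addFundamentalInterior.1 (hWV x.2)).2 _ hne'
    refine h1 ?_
    rw [Set.mem_vadd_set_iff_neg_vadd_mem]
    have := (mem_addFundamentalInterior.1 (hWV x'.2)).1
    simpa [Submodule.vadd_def] using this
  have hmeas : Measurable (fun x : W => torusMap Y x) :=
    (continuous_torusMap Y).measurable.comp measurable_subtype_coe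
  have : StandardBorelSpace W := hW.standardBorel
  -- Lusin–Souslin: an injective Borel map on a standard Borel space has Borel images, so the
  -- inverse on the image is measurable.
  have hemb : MeasurableEmbedding (fun x : W => torusMap Y x) := hmeas.measurableEmbedding hinj
  refine ⟨Function.extend (fun x : W => torusMap Y x) (fun x : W => f x) 0,
    hemb.measurable_extend (hf.comp measurable_subtype_coe) measurable_zero, ?_⟩
  rw [Filter.EventuallyEq, hV.ae_cellMeasure_iff, ae_restrict_iff'₀ hV.nullMeasurableSet]
  have hWV' : W =ᵐ[volume] V := by
    refine hWe.trans ?_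
    refine (LE.le.eventuallyLE addFundamentalInterior_subset).antisymm ?_
    rw [ae_le_set, sdiff_addFundamentalInterior]
    exact hV.measure_addFundamentalFrontier
  filter_upwards [hWV'] with x hx hxV
  have hxW : x ∈ W := by
    have : (x ∈ W) = (x ∈ V) := hx
    rwa [this]
  exact (hinj.extend_apply (fun x : W => f x) 0 ⟨x, hxW⟩).symm

/-- The Fourier mode of frequency `k` on the cell. -/
def fourierMode (Y : Module.Basis (Fin d) ℝ (Space d)) (k : Fin d → ℤ) (x : Space d) : ℂ :=
  Complex.exp (phase Y k x * Complex.I)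

lemma continuous_fourierMode (k : Fin d → ℤ) : Continuous (fourierMode Y k) := by
  unfold fourierMode; fun_prop

lemma norm_fourierMode (k : Fin d → ℤ) (x : Space d) : ‖fourierMode Y k x‖ = 1 :=
  Complex.norm_exp_ofReal_mul_I _

lemma IsUnitCell.memLp_fourierMode (hV : IsUnitCell Y V) (k : Fin d → ℤ) :
    MemLp (fourierMode Y k) 2 (cellMeasure V) := by
  have := hV.isProbabilityMeasure
  exact MemLp.of_bound (continuous_fourierMode k).aestronglyMeasurable 1
    (Filter.Eventually.of_forall fun x => (norm_fourierMode k x).le)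

lemma phase_add_lattice (k : Fin d → ℤ) {y : Space d} (hy : y ∈ lattice Y) :
    ∃ n : ℤ, phase Y k y = n * (2 * Real.pi) := by
  choose n hn using (mem_lattice_iff Y y).1 hy
  refine ⟨∑ i, k i * n i, ?_⟩
  rw [phase_apply]
  push_cast
  rw [Finset.sum_mul]
  refine Finset.sum_congr rfl fun i _ => ?_
  rw [← hn]; ring

lemma phase_sub (k l : Fin d → ℤ) (x : Space d) : phase Y (k - l) x = phase Y k x - phase Y l x := by
  simp only [phase_apply, ← Finset.sum_sub_distrib]
  refine Finset.sum_congr rfl fun i _ => ?_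
  push_cast [Pi.sub_apply]; ring

lemma fourierMode_add_lattice (k : Fin d → ℤ) {y : Space d} (hy : y ∈ lattice Y) (x : Space d) :
    fourierMode Y k (x + y) = fourierMode Y k x := by
  unfold fourierMode
  rw [← mFourier_torusMap, ← mFourier_torusMap, torusMap_add Y hy]

/-- Cell averages of periodic functions are invariant under translations. -/
lemma IsUnitCell.integral_translate (hV : IsUnitCell Y V) {E : Type*} [NormedAddCommGroup E]
    [NormedSpace ℝ E] {ψ : Space d → E} (hψ : ∀ y ∈ lattice Y, ∀ x, ψ (x + y) = ψ x)
    (h : Space d) : ∫ x, ψ (h + x) ∂cellMeasure V = ∫ x, ψ x ∂cellMeasure V := by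
  -- Translations commute, so the shifted cell is again a fundamental domain, and a periodic
  -- function has the same integral over both.
  have hV' : IsAddFundamentalDomain (lattice Y) (h +ᵥ V) (volume : Measure (Space d)) :=
    hV.vadd_of_comm h
  have e1 : ∫ x in h +ᵥ V, ψ x = ∫ x in V, ψ x := by
    refine hV'.setIntegral_eq hV fun y x => ?_
    rw [Submodule.vadd_def, vadd_eq_add, add_comm]
    exact hψ y y.2 x
  have e2 : ∫ x in h +ᵥ V, ψ x = ∫ x in V, ψ (h + x) := by
    rw [← (measurePreserving_add_left volume h).setIntegral_image_emb
      (measurableEmbedding_addLeft h) ψ V]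
    rfl
  rw [e1, hV.setIntegral_eq_smul, hV.setIntegral_eq_smul] at e2
  exact (smul_right_injective _ hV.volume_toReal_ne_zero e2).symm

/-- If `k j ≠ 0`, the shift by `Y j / (2 k j)` changes the phase by `π` and the sign of the mode,
but not its average. -/
lemma IsUnitCell.integral_fourierMode (hV : IsUnitCell Y V) {k : Fin d → ℤ} (hk : k ≠ 0) :
    ∫ x, fourierMode Y k x ∂cellMeasure V = 0 := by
  obtain ⟨j, hj⟩ := Function.ne_iff.1 hk
  have hj' : (k j : ℝ) ≠ 0 := by exact_mod_cast hj
  set h : Space d := (2 * k j : ℝ)⁻¹ • Y j with hh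
  have hph : phase Y k h = Real.pi := by
    rw [phase_apply, Finset.sum_eq_single j]
    · simp only [hh, map_smul, Module.Basis.repr_self, Finsupp.smul_apply, Finsupp.single_eq_same,
        smul_eq_mul, mul_one]
      field_simp
    · intro i _ hi
      simp [hh, hi.symm]
    · simp
  have hshift : ∀ x, fourierMode Y k (h + x) = - fourierMode Y k x := by
    intro x
    unfold fourierMode
    rw [map_add, hph]
    push_cast
    rw [add_mul, Complex.exp_add, Complex.exp_pi_mul_I]
    ring
  have e := hV.integral_translate (fun y hy x => fourierMode_add_lattice k hy x) h
  simp_rw [hshift, integral_neg] at e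
  exact neg_eq_self.1 e

lemma IsUnitCell.orthonormal_fourierMode (hV : IsUnitCell Y V) :
    Orthonormal ℂ fun k => ((hV.memLp_fourierMode k).toLp _) := by
  have := hV.isProbabilityMeasure
  have key : ∀ k l : Fin d → ℤ, ⟪((hV.memLp_fourierMode k).toLp _), ((hV.memLp_fourierMode l).toLp _)⟫_ℂ
      = ∫ x, fourierMode Y (l - k) x ∂cellMeasure V := by
    intro k l
    rw [L2.inner_def]
    refine integral_congr_ae ?_
    filter_upwards [(hV.memLp_fourierMode k).coeFn_toLp, (hV.memLp_fourierMode l).coeFn_toLp]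
      with x h1 h2
    rw [h1, h2, RCLike.inner_apply]
    unfold fourierMode
    rw [← Complex.exp_conj, ← Complex.exp_add, phase_sub]
    congr 1
    simp
    ring
  rw [orthonormal_iff_ite]
  intro k l
  rw [key]
  split_ifs with h
  · simp [h, fourierMode, phase_apply]
  · exact hV.integral_fourierMode (sub_ne_zero.2 (Ne.symm h))

/-- A function orthogonal to every mode descends to the torus with the pushforward `μ` of the cell
measure. Trigonometric polynomials are uniformly dense in the continuous functions, hence dense in
`L²(μ)` whatever the finite measure `μ` is, so `μ` need not be identified with Haar measure. -/
lemma IsUnitCell.orthogonal_fourierMode (hV : IsUnitCell Y V) :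
    (Submodule.span ℂ (Set.range fun k => ((hV.memLp_fourierMode k).toLp _)))ᗮ = ⊥ := by
  have := hV.isProbabilityMeasure
  rw [Submodule.eq_bot_iff]
  intro f hf
  obtain ⟨g, hg, hfg⟩ := hV.exists_comp_torusMap (Lp.stronglyMeasurable f).measurable
  have hΦ : Measurable (torusMap Y) := (continuous_torusMap Y).measurable
  set μ : Measure (UnitAddTorus (Fin d)) := (cellMeasure V).map (torusMap Y) with hμ
  have : IsProbabilityMeasure μ := Measure.isProbabilityMeasure_map hΦ.aemeasurable
  have hgL : MemLp g 2 μ := by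
    rw [hμ, memLp_map_measure_iff hg.aestronglyMeasurable hΦ.aemeasurable]
    exact (Lp.memLp f).ae_eq hfg
  have hdense : (Submodule.span ℂ (Set.range fun k : Fin d → ℤ =>
      ContinuousMap.toLp (E := ℂ) 2 μ ℂ (UnitAddTorus.mFourier k))).topologicalClosure = ⊤ := by
    simpa only [Submodule.map_span, ContinuousLinearMap.coe_coe, ← Set.range_comp,
      Function.comp_def] using
      (ContinuousMap.toLp_denseRange ℂ μ ℂ (p := 2) ENNReal.ofNat_ne_top).topologicalClosure_map_submodule
        (UnitAddTorus.span_mFourier_closure_eq_top (d := Fin d))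
  have hg0 : (hgL.toLp g) = 0 := by
    have hmem : (hgL.toLp g) ∈ (Submodule.span ℂ (Set.range fun k : Fin d → ℤ =>
      ContinuousMap.toLp (E := ℂ) 2 μ ℂ (UnitAddTorus.mFourier k)))ᗮ := by
      rw [Submodule.mem_orthogonal]
      intro u hu
      induction hu using Submodule.span_induction with
      | zero => simp
      | add a b _ _ ha hb => rw [inner_add_left, ha, hb, add_zero]
      | smul c a _ ha => rw [inner_smul_left, ha, mul_zero]
      | mem u hu =>
        obtain ⟨k, rfl⟩ := hu
        have h1 := (Submodule.mem_orthogonal _ _).1 hf _ (Submodule.subset_span ⟨k, rfl⟩)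
        rw [L2.inner_def] at h1 ⊢
        have e : ∫ t, ⟪(ContinuousMap.toLp (E := ℂ) 2 μ ℂ (UnitAddTorus.mFourier k)) t,
            (hgL.toLp g) t⟫_ℂ ∂μ = ∫ t, g t * conj (UnitAddTorus.mFourier k t) ∂μ := by
          refine integral_congr_ae ?_
          filter_upwards [ContinuousMap.coeFn_toLp (E := ℂ) (p := 2) (𝕜 := ℂ) μ
            (UnitAddTorus.mFourier k), hgL.coeFn_toLp] with t h1 h2
          rw [h1, h2, RCLike.inner_apply]
        rw [e, hμ, integral_map hΦ.aemeasurable, ← h1]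
        · refine integral_congr_ae ?_
          filter_upwards [(hV.memLp_fourierMode k).coeFn_toLp, hfg] with x h2 h3
          rw [h2, h3, RCLike.inner_apply, mFourier_torusMap]
          rfl
        · exact (hg.mul (Complex.continuous_conj.measurable.comp
            (UnitAddTorus.mFourier k).continuous.measurable)).aestronglyMeasurable
    rw [← Submodule.orthogonal_closure, hdense, Submodule.top_orthogonal_eq_bot] at hmem
    exact (Submodule.mem_bot ℂ).1 hmem
  have hg1 : g =ᵐ[μ] 0 := by
    have := hgL.coeFn_toLp
    rw [hg0] at this
    exact this.symm.trans (Lp.coeFn_zero _ _ _)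
  have hg2 : g ∘ torusMap Y =ᵐ[cellMeasure V] 0 := ae_of_ae_map hΦ.aemeasurable hg1
  exact (Lp.eq_zero_iff_ae_eq_zero).2 (hfg.trans hg2)

/-- The Fourier modes form a Hilbert basis of the square integrable functions on the cell. -/
def IsUnitCell.fourierBasis (hV : IsUnitCell Y V) :
    HilbertBasis (Fin d → ℤ) ℂ (Lp ℂ 2 (cellMeasure V)) :=
  HilbertBasis.mkOfOrthogonalEqBot hV.orthonormal_fourierMode hV.orthogonal_fourierMode

/-- The cosine Fourier coefficient of a real function on the cell. -/
def cosCoeff (Y : Module.Basis (Fin d) ℝ (Space d)) (V : Set (Space d)) (k : Fin d → ℤ)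
    (f : Space d → ℝ) : ℝ := ∫ x, f x * Real.cos (phase Y k x) ∂cellMeasure V

/-- The sine Fourier coefficient of a real function on the cell. -/
def sinCoeff (Y : Module.Basis (Fin d) ℝ (Space d)) (V : Set (Space d)) (k : Fin d → ℤ)
    (f : Space d → ℝ) : ℝ := ∫ x, f x * Real.sin (phase Y k x) ∂cellMeasure V

lemma IsUnitCell.integrable_mul (hV : IsUnitCell Y V) {f ψ : Space d → ℝ}
    (hf : MemLp f 2 (cellMeasure V)) (hψ : Continuous ψ) {C : ℝ} (hC : ∀ x, |ψ x| ≤ C) :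
    Integrable (fun x => f x * ψ x) (cellMeasure V) := by
  have := hV.isProbabilityMeasure
  exact (hf.integrable one_le_two).mul_bdd hψ.aestronglyMeasurable
    (Filter.Eventually.of_forall hC)

lemma IsUnitCell.inner_fourierMode (hV : IsUnitCell Y V) {f : Space d → ℝ}
    (hf : MemLp f 2 (cellMeasure V)) (k : Fin d → ℤ) :
    ⟪((hV.memLp_fourierMode k).toLp _), ((hf.ofReal (K := ℂ)).toLp _)⟫_ℂ
      = cosCoeff Y V k f - sinCoeff Y V k f * Complex.I := by
  rw [L2.inner_def]
  unfold cosCoeff sinCoeff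
  rw [← integral_complex_ofReal, ← integral_complex_ofReal, ← integral_mul_const,
    ← integral_sub]
  · refine integral_congr_ae ?_
    filter_upwards [(hV.memLp_fourierMode k).coeFn_toLp, (hf.ofReal (K := ℂ)).coeFn_toLp]
      with x h1 h2
    rw [h1, h2, RCLike.inner_apply]
    unfold fourierMode
    rw [Complex.exp_mul_I, map_add, map_mul, Complex.conj_I, ← Complex.ofReal_cos,
      ← Complex.ofReal_sin, Complex.conj_ofReal, Complex.conj_ofReal]
    simp
    ring
  · exact (hV.integrable_mul hf (by fun_prop) fun x => Real.abs_cos_le_one _).ofReal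
  · exact (hV.integrable_mul hf (by fun_prop) fun x => Real.abs_sin_le_one _).ofReal.mul_const _

/-- Parseval's identity for real functions on the cell. -/
lemma IsUnitCell.hasSum_coeff (hV : IsUnitCell Y V) {f g : Space d → ℝ}
    (hf : MemLp f 2 (cellMeasure V)) (hg : MemLp g 2 (cellMeasure V)) :
    HasSum (fun k => cosCoeff Y V k f * cosCoeff Y V k g + sinCoeff Y V k f * sinCoeff Y V k g)
      (∫ x, f x * g x ∂cellMeasure V) := by
  have h := hV.fourierBasis.hasSum_inner_mul_inner ((hf.ofReal (K := ℂ)).toLp _)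
    ((hg.ofReal (K := ℂ)).toLp _)
  have h' := h.mapL Complex.reCLM
  convert h' using 1
  · ext k
    have e : hV.fourierBasis k = ((hV.memLp_fourierMode k).toLp _) := by
      simp [IsUnitCell.fourierBasis]
    rw [e, ← inner_conj_symm, hV.inner_fourierMode hf, hV.inner_fourierMode hg]
    simp
  · rw [L2.inner_def]
    have : ∫ x, ⟪((hf.ofReal (K := ℂ)).toLp _) x, ((hg.ofReal (K := ℂ)).toLp _) x⟫_ℂ ∂cellMeasure V
        = ∫ x, ((f x * g x : ℝ) : ℂ) ∂cellMeasure V := by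
      refine integral_congr_ae ?_
      filter_upwards [(hf.ofReal (K := ℂ)).coeFn_toLp, (hg.ofReal (K := ℂ)).coeFn_toLp]
        with x h1 h2
      rw [h1, h2, RCLike.inner_apply]
      simp [mul_comm]
    rw [this, integral_complex_ofReal]
    simp

end

/-! ### Test functions, weak derivatives in Fourier variables, Poincaré's inequality -/

section

variable {Y : Module.Basis (Fin d) ℝ (Space d)} {V : Set (Space d)}

/-- Every point is a lattice translate of one in the bounded parallelepiped of the basis, whose
closure is compact. -/
lemma exists_bound_of_periodic {ψ : Space d → ℝ} (hψ : Continuous ψ)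
    (hper : ∀ y ∈ lattice Y, ∀ x, ψ (x + y) = ψ x) : ∃ C, ∀ x, |ψ x| ≤ C := by
  have hK : IsCompact (closure (ZSpan.fundamentalDomain Y)) :=
    (ZSpan.fundamentalDomain_isBounded Y).isCompact_closure
  obtain ⟨C, hC⟩ := hK.exists_bound_of_continuousOn hψ.continuousOn
  refine ⟨C, fun x => ?_⟩
  have h := hper _ (-ZSpan.floor Y x).2 x
  have : x + ((-ZSpan.floor Y x : lattice Y) : Space d) = ZSpan.fract Y x := by
    rw [ZSpan.fract_apply]; simp [sub_eq_add_neg]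
  rw [← h, this]
  exact hC _ (subset_closure (ZSpan.fract_mem_fundamentalDomain Y x))

namespace IsTest

variable {φ : Space d → ℝ}

lemma continuous (hφ : IsTest Y φ) : Continuous φ := hφ.1.continuous

lemma continuous_pderiv (hφ : IsTest Y φ) (j : Fin d) : Continuous (pderiv j φ) := by
  unfold pderiv
  exact (hφ.1.continuous_fderiv (by simp)).clm_apply continuous_const

lemma exists_bound (hφ : IsTest Y φ) : ∃ C, ∀ x, |φ x| ≤ C :=
  exists_bound_of_periodic hφ.continuous hφ.2

lemma exists_bound_pderiv (hφ : IsTest Y φ) (j : Fin d) : ∃ C, ∀ x, |pderiv j φ x| ≤ C := by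
  refine exists_bound_of_periodic (Y := Y) (hφ.continuous_pderiv j) fun y hy x => ?_
  unfold pderiv
  rw [← fderiv_comp_add_right]
  simp_rw [hφ.2 y hy]

end IsTest

lemma cos_phase_add (k : Fin d → ℤ) {y : Space d} (hy : y ∈ lattice Y) (x : Space d) :
    Real.cos (phase Y k (x + y)) = Real.cos (phase Y k x) := by
  obtain ⟨n, hn⟩ := phase_add_lattice k hy
  rw [map_add, hn, Real.cos_add_int_mul_two_pi]

lemma sin_phase_add (k : Fin d → ℤ) {y : Space d} (hy : y ∈ lattice Y) (x : Space d) :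
    Real.sin (phase Y k (x + y)) = Real.sin (phase Y k x) := by
  obtain ⟨n, hn⟩ := phase_add_lattice k hy
  rw [map_add, hn, Real.sin_add_int_mul_two_pi]

lemma isTest_cos (k : Fin d → ℤ) : IsTest Y fun x => Real.cos (phase Y k x) :=
  ⟨Real.contDiff_cos.comp (phase Y k).contDiff, fun _ hy x => cos_phase_add k hy x⟩

lemma isTest_sin (k : Fin d → ℤ) : IsTest Y fun x => Real.sin (phase Y k x) :=
  ⟨Real.contDiff_sin.comp (phase Y k).contDiff, fun _ hy x => sin_phase_add k hy x⟩

/-- The components of the wave vector of frequency `k`. -/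
def waveVector (Y : Module.Basis (Fin d) ℝ (Space d)) (k : Fin d → ℤ) (j : Fin d) : ℝ :=
  phase Y k (EuclideanSpace.single j 1)

lemma pderiv_cos (k : Fin d → ℤ) (j : Fin d) (x : Space d) :
    pderiv j (fun x => Real.cos (phase Y k x)) x
      = -(waveVector Y k j * Real.sin (phase Y k x)) := by
  unfold pderiv waveVector
  rw [((phase Y k).hasFDerivAt.cos).fderiv]
  simp; ring

lemma pderiv_sin (k : Fin d → ℤ) (j : Fin d) (x : Space d) :
    pderiv j (fun x => Real.sin (phase Y k x)) x
      = waveVector Y k j * Real.cos (phase Y k x) := by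
  unfold pderiv waveVector
  rw [((phase Y k).hasFDerivAt.sin).fderiv]
  simp; ring

/-- The weak formulation in terms of cell averages. -/
lemma IsUnitCell.hasWeakPDeriv_iff (hV : IsUnitCell Y V) {j : Fin d} {f g : Space d → ℝ} :
    HasWeakPDeriv Y V j f g ↔ ∀ φ : Space d → ℝ, IsTest Y φ →
      ∫ x, f x * pderiv j φ x ∂cellMeasure V = - ∫ x, g x * φ x ∂cellMeasure V := by
  unfold HasWeakPDeriv
  refine forall₂_congr fun φ _ => ?_
  rw [hV.setIntegral_eq_smul, hV.setIntegral_eq_smul, ← smul_neg]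
  exact smul_right_inj hV.volume_toReal_ne_zero

/-- The average of a translated periodic function does not depend on the translation; its derivative
in the translation parameter is taken under the integral. No divergence theorem on `V` is needed. -/
lemma IsUnitCell.integral_pderiv (hV : IsUnitCell Y V) {φ : Space d → ℝ} (hφ : IsTest Y φ)
    (j : Fin d) : ∫ x, pderiv j φ x ∂cellMeasure V = 0 := by
  have := hV.isProbabilityMeasure
  obtain ⟨C, hC⟩ := hφ.exists_bound_pderiv j
  obtain ⟨C', hC'⟩ := hφ.exists_bound
  have hd : ∀ (x : Space d) (t : ℝ), HasDerivAt
      (fun t : ℝ => φ (t • EuclideanSpace.single j 1 + x))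
      (pderiv j φ (t • EuclideanSpace.single j 1 + x)) t := by
    intro x t
    have h1 : HasDerivAt (fun t : ℝ => t • (EuclideanSpace.single j 1 : Space d) + x)
        (EuclideanSpace.single j 1) t := by
      simpa using ((hasDerivAt_id t).smul_const (EuclideanSpace.single j 1 : Space d)).add_const x
    exact ((hφ.1.differentiable (by simp)) _).hasFDerivAt.comp_hasDerivAt t h1
  have hc : ∀ {ψ : Space d → ℝ}, Continuous ψ → ∀ t : ℝ,
      AEStronglyMeasurable (fun x => ψ (t • EuclideanSpace.single j 1 + x)) (cellMeasure V) :=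
    fun hψ t => (hψ.comp (continuous_const_add _)).aestronglyMeasurable
  have key := hasDerivAt_integral_of_dominated_loc_of_deriv_le (μ := cellMeasure V)
    (F := fun (t : ℝ) x => φ (t • EuclideanSpace.single j 1 + x))
    (F' := fun (t : ℝ) x => pderiv j φ (t • EuclideanSpace.single j 1 + x))
    (x₀ := 0) (bound := fun _ => C) Filter.univ_mem
    (Filter.Eventually.of_forall (hc hφ.continuous))
    (Integrable.of_bound (hc hφ.continuous 0) C' (Filter.Eventually.of_forall fun x => hC' _))
    (hc (hφ.continuous_pderiv j) 0)
    (Filter.Eventually.of_forall fun x t _ => hC _) (integrable_const _)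
    (Filter.Eventually.of_forall fun x t _ => hd x t)
  have h2 := key.2
  simp_rw [hV.integral_translate hφ.2] at h2
  simpa using h2.unique (hasDerivAt_const _ _)

/-- Cosine and sine modes are themselves test functions; testing with them turns a weak derivative
into multiplication by the wave vector, exchanging the two kinds of coefficient. -/
lemma IsUnitCell.cosCoeff_weakPDeriv (hV : IsUnitCell Y V) {j : Fin d} {f g : Space d → ℝ}
    (h : HasWeakPDeriv Y V j f g) (k : Fin d → ℤ) :
    cosCoeff Y V k g = waveVector Y k j * sinCoeff Y V k f := by
  have h1 := hV.hasWeakPDeriv_iff.1 h _ (isTest_cos k)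
  simp_rw [pderiv_cos] at h1
  unfold cosCoeff sinCoeff
  rw [← neg_eq_iff_eq_neg.2 h1, ← integral_neg, ← integral_const_mul]
  exact integral_congr_ae (Filter.Eventually.of_forall fun x => by simp only; ring)

lemma IsUnitCell.sinCoeff_weakPDeriv (hV : IsUnitCell Y V) {j : Fin d} {f g : Space d → ℝ}
    (h : HasWeakPDeriv Y V j f g) (k : Fin d → ℤ) :
    sinCoeff Y V k g = -(waveVector Y k j * cosCoeff Y V k f) := by
  have h1 := hV.hasWeakPDeriv_iff.1 h _ (isTest_sin k)
  simp_rw [pderiv_sin] at h1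
  unfold cosCoeff sinCoeff
  rw [← neg_eq_iff_eq_neg.2 h1, neg_inj, ← integral_const_mul]
  exact integral_congr_ae (Filter.Eventually.of_forall fun x => by simp only; ring)

/-- This is the spectral gap behind Poincaré's inequality. The wave vector paired with `Y l` gives
`2π k l`, of modulus at least one for some `l`; Cauchy–Schwarz does the rest. -/
lemma one_le_sum_waveVector_sq {k : Fin d → ℤ} (hk : k ≠ 0) :
    1 ≤ (∑ l, ‖Y l‖ ^ 2) * ∑ j, waveVector Y k j ^ 2 := by
  obtain ⟨l, hl⟩ := Function.ne_iff.1 hk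
  have h1 : phase Y k (Y l) = 2 * Real.pi * k l := by
    rw [phase_apply, Finset.sum_eq_single l]
    · simp
    · intro i _ hi
      simp [hi.symm]
    · simp
  have h2 : phase Y k (Y l) = ∑ j, (Y l) j * waveVector Y k j := by
    conv_lhs => rw [← (EuclideanSpace.basisFun (Fin d) ℝ).sum_repr (Y l)]
    simp [waveVector]
  have h3 : 1 ≤ (phase Y k (Y l)) ^ 2 := by
    have : (1 : ℝ) ≤ (k l : ℝ) ^ 2 := by
      have : (1 : ℤ) ≤ (k l) ^ 2 := by
        have := sq_pos_of_ne_zero hl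
        simpa using Int.add_one_le_of_lt this
      exact_mod_cast this
    have hpi : 1 ≤ (2 * Real.pi) ^ 2 := by nlinarith [Real.pi_gt_three]
    rw [h1, mul_pow]
    exact one_le_mul_of_one_le_of_one_le hpi this
  have h4 : (∑ j, (Y l) j * waveVector Y k j) ^ 2 ≤ ‖Y l‖ ^ 2 * ∑ j, waveVector Y k j ^ 2 := by
    refine (Finset.sum_mul_sq_le_sq_mul_sq _ _ _).trans_eq ?_
    rw [EuclideanSpace.norm_sq_eq]
    simp
  rw [h2] at h3
  refine h3.trans (h4.trans ?_)
  gcongr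
  exact Finset.single_le_sum (f := fun l => ‖Y l‖ ^ 2) (fun _ _ => by positivity)
    (Finset.mem_univ l)

/-- Poincaré's inequality for periodic functions. -/
lemma IsUnitCell.poincare (hV : IsUnitCell Y V) {f : Space d → ℝ} {g : Fin d → Space d → ℝ}
    (hf : MemLp f 2 (cellMeasure V)) (hg : ∀ j, MemLp (g j) 2 (cellMeasure V))
    (hw : ∀ j, HasWeakPDeriv Y V j f (g j)) (h0 : ∫ x, f x ∂cellMeasure V = 0) :
    ∫ x, f x * f x ∂cellMeasure V
      ≤ (∑ l, ‖Y l‖ ^ 2) * ∑ j, ∫ x, g j x * g j x ∂cellMeasure V := by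
  refine hasSum_le (fun k => ?_) (hV.hasSum_coeff hf hf)
    ((hasSum_sum fun j (_ : j ∈ Finset.univ) => hV.hasSum_coeff (hg j) (hg j)).mul_left
      (∑ l, ‖Y l‖ ^ 2))
  -- The zero frequency is the only one without a gap, and there the coefficient of `f` is its mean.
  rcases eq_or_ne k 0 with rfl | hk
  · have h1 : cosCoeff Y V 0 f = 0 := by simpa [cosCoeff, phase_apply] using h0
    have h2 : sinCoeff Y V 0 f = 0 := by simp [sinCoeff, phase_apply]
    rw [h1, h2]
    simp only [mul_zero, add_zero]
    exact mul_nonneg (Finset.sum_nonneg fun _ _ => by positivity)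
      (Finset.sum_nonneg fun _ _ => add_nonneg (mul_self_nonneg _) (mul_self_nonneg _))
  · have e : ∀ j, cosCoeff Y V k (g j) * cosCoeff Y V k (g j)
        + sinCoeff Y V k (g j) * sinCoeff Y V k (g j)
        = waveVector Y k j ^ 2 * (cosCoeff Y V k f * cosCoeff Y V k f
          + sinCoeff Y V k f * sinCoeff Y V k f) := by
      intro j
      rw [hV.cosCoeff_weakPDeriv (hw j), hV.sinCoeff_weakPDeriv (hw j)]
      ring
    simp_rw [e]
    rw [← Finset.sum_mul, ← mul_assoc]
    exact le_mul_of_one_le_left (add_nonneg (mul_self_nonneg _) (mul_self_nonneg _))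
      (one_le_sum_waveVector_sq hk)

/-- The identity behind Korn's inequality for periodic fields. -/
lemma IsUnitCell.integral_grad_mul_transpose (hV : IsUnitCell Y V) {w : Fin d → Space d → ℝ}
    {G : Fin d → Fin d → Space d → ℝ} (hG : ∀ i j, MemLp (G i j) 2 (cellMeasure V))
    (hw : ∀ i j, HasWeakPDeriv Y V j (w i) (G i j)) (i j : Fin d) :
    ∫ x, G i j x * G j i x ∂cellMeasure V = ∫ x, G i i x * G j j x ∂cellMeasure V := by
  -- At each frequency both integrands contribute `ξ_i ξ_j` times the product of the coefficients of
  -- `w i` and `w j`, `ξ` being the wave vector.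
  refine (hV.hasSum_coeff (hG i j) (hG j i)).unique ?_
  convert hV.hasSum_coeff (hG i i) (hG j j) using 2 with k
  rw [hV.cosCoeff_weakPDeriv (hw i j), hV.sinCoeff_weakPDeriv (hw i j),
    hV.cosCoeff_weakPDeriv (hw j i), hV.sinCoeff_weakPDeriv (hw j i),
    hV.cosCoeff_weakPDeriv (hw i i), hV.sinCoeff_weakPDeriv (hw i i),
    hV.cosCoeff_weakPDeriv (hw j j), hV.sinCoeff_weakPDeriv (hw j j)]
  ring

/-- Divergence-free fields are orthogonal to gradients. -/
lemma IsUnitCell.sum_integral_divFree_mul_grad (hV : IsUnitCell Y V) {f : Space d → ℝ}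
    {g s : Fin d → Space d → ℝ} (hg : ∀ j, MemLp (g j) 2 (cellMeasure V))
    (hs : ∀ j, MemLp (s j) 2 (cellMeasure V)) (hw : ∀ j, HasWeakPDeriv Y V j f (g j))
    (hdiv : ∀ φ, IsTest Y φ → ∫ x, ∑ j, s j x * pderiv j φ x ∂cellMeasure V = 0) :
    ∑ j, ∫ x, s j x * g j x ∂cellMeasure V = 0 := by
  have hdiv' : ∀ φ, IsTest Y φ → ∑ j, ∫ x, s j x * pderiv j φ x ∂cellMeasure V = 0 := by
    intro φ hφ
    rw [← hdiv φ hφ, integral_finsetSum]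
    intro j _
    obtain ⟨C, hC⟩ := hφ.exists_bound_pderiv j
    exact hV.integrable_mul (hs j) (hφ.continuous_pderiv j) hC
  refine (hasSum_sum fun j (_ : j ∈ Finset.univ) =>
    hV.hasSum_coeff (hs j) (hg j)).unique ?_
  convert hasSum_zero using 2 with k
  -- In Fourier variables zero divergence means that the coefficients of `s` are orthogonal to the
  -- wave vector, whereas those of a gradient are parallel to it.
  have h1 : ∑ j, waveVector Y k j * sinCoeff Y V k (s j) = 0 := by
    have := hdiv' _ (isTest_cos k)
    simp_rw [pderiv_cos] at this
    rw [← neg_eq_zero, ← this, ← Finset.sum_neg_distrib]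
    refine Finset.sum_congr rfl fun j _ => ?_
    unfold sinCoeff
    rw [← integral_const_mul, ← integral_neg]
    exact integral_congr_ae (Filter.Eventually.of_forall fun x => by simp only; ring)
  have h2 : ∑ j, waveVector Y k j * cosCoeff Y V k (s j) = 0 := by
    have := hdiv' _ (isTest_sin k)
    simp_rw [pderiv_sin] at this
    rw [← this]
    refine Finset.sum_congr rfl fun j _ => ?_
    unfold cosCoeff
    rw [← integral_const_mul]
    exact integral_congr_ae (Filter.Eventually.of_forall fun x => by simp only; ring)
  calc _ = (∑ j, waveVector Y k j * cosCoeff Y V k (s j)) * sinCoeff Y V k f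
        - (∑ j, waveVector Y k j * sinCoeff Y V k (s j)) * cosCoeff Y V k f := by
        rw [Finset.sum_mul, Finset.sum_mul, ← Finset.sum_sub_distrib]
        refine Finset.sum_congr rfl fun j _ => ?_
        rw [hV.cosCoeff_weakPDeriv (hw j), hV.sinCoeff_weakPDeriv (hw j)]
        ring
    _ = 0 := by rw [h1, h2]; ring

end

/-! ### Projections for coercive forms; self-equilibrated fields as a closed subspace -/

section

/-- Existence of projections onto closed subspaces for a coercive form. -/
lemma exists_proj_of_coercive {H : Type*} [NormedAddCommGroup H] [InnerProductSpace ℝ H]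
    [CompleteSpace H] (T : H →L[ℝ] H) {α : ℝ} (hα : 0 < α) (hT : ∀ u, α * ‖u‖ ^ 2 ≤ ⟪T u, u⟫_ℝ)
    (K : Submodule ℝ H) (hK : IsClosed (K : Set H)) (f : H) :
    ∃ p ∈ K, ∀ k ∈ K, ⟪T (f - p), k⟫_ℝ = 0 := by
  have : CompleteSpace K := hK.completeSpace_coe
  -- Lax–Milgram for the form compressed to `K`. Treating the energetic product as a coercive form
  -- keeps the standard `L²` structure in place.
  let B : K →L[ℝ] K →L[ℝ] ℝ :=
    (innerSL ℝ).comp (K.orthogonalProjectionOnto.comp (T.comp K.subtypeL))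
  have hB : ∀ u v : K, B u v = ⟪T u, v⟫_ℝ := by
    intro u v
    simp [B]
  have hc : IsCoercive B := by
    refine ⟨α, hα, fun u => ?_⟩
    rw [hB, mul_assoc, ← sq]
    exact hT u
  let p := hc.continuousLinearEquivOfBilin.symm (K.orthogonalProjectionOnto (T f))
  refine ⟨p, p.2, fun k hk => ?_⟩
  have h1 := hc.continuousLinearEquivOfBilin_apply p ⟨k, hk⟩
  rw [hB] at h1
  simp only [p, ContinuousLinearEquiv.apply_symm_apply] at h1
  rw [map_sub, inner_sub_left, sub_eq_zero]
  rw [← h1]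
  simp

variable {Y : Module.Basis (Fin d) ℝ (Space d)} {V : Set (Space d)}

/-- An entry of a symmetric tensor, as a continuous linear functional. -/
def entry (i j : Fin d) : SymTensor d →L[ℝ] ℝ :=
  (EuclideanSpace.proj (i, j)).comp (symTensors d).subtypeL

@[simp] lemma entry_apply (i j : Fin d) (e : SymTensor d) :
    entry i j e = (e : EuclideanSpace ℝ (Fin d × Fin d)) (i, j) := rfl

lemma inner_eq_sum_entry (s e : SymTensor d) :
    ⟪s, e⟫_ℝ = ∑ i, ∑ j, entry i j s * entry i j e := by
  rw [Submodule.coe_inner, PiLp.inner_apply, Fintype.sum_prod_type]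
  simp [mul_comm]

lemma ext_entry {s e : SymTensor d} (h : ∀ i j, entry i j s = entry i j e) : s = e := by
  ext ⟨i, j⟩
  exact h i j

/-- The functional `u ↦ ∫ ψ ℓ(u)`. -/
def moment {μ : Measure (Space d)} {E : Type*} [NormedAddCommGroup E] [NormedSpace ℝ E]
    {ψ : Space d → ℝ} (hψ : MemLp ψ 2 μ) (ℓ : E →L[ℝ] ℝ) : Lp E 2 μ →L[ℝ] ℝ :=
  (innerSL ℝ (hψ.toLp ψ)).comp (ℓ.compLpL 2 μ)

lemma moment_apply {μ : Measure (Space d)} {E : Type*} [NormedAddCommGroup E] [NormedSpace ℝ E]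
    {ψ : Space d → ℝ} (hψ : MemLp ψ 2 μ) (ℓ : E →L[ℝ] ℝ) (u : Lp E 2 μ) :
    moment hψ ℓ u = ∫ x, ℓ (u x) * ψ x ∂μ := by
  simp only [moment, ContinuousLinearMap.comp_apply, innerSL_apply_apply]
  rw [L2.inner_def]
  refine integral_congr_ae ?_
  filter_upwards [hψ.coeFn_toLp, ℓ.coeFn_compLpL u] with x h1 h2
  rw [h1, h2]
  simp

lemma norm_sq_eq_integral {μ : Measure (Space d)} {E : Type*} [NormedAddCommGroup E]
    [InnerProductSpace ℝ E] (u : Lp E 2 μ) : ‖u‖ ^ 2 = ∫ x, ‖u x‖ ^ 2 ∂μ := by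
  rw [← real_inner_self_eq_norm_sq, L2.inner_def]
  simp_rw [real_inner_self_eq_norm_sq]

namespace IsUnitCell

lemma memLp_of_bound (hV : IsUnitCell Y V) {ψ : Space d → ℝ} (hψ : Continuous ψ)
    (hC : ∃ C, ∀ x, |ψ x| ≤ C) : MemLp ψ 2 (cellMeasure V) := by
  have := hV.isProbabilityMeasure
  obtain ⟨C, hC⟩ := hC
  exact MemLp.of_bound hψ.aestronglyMeasurable C (Filter.Eventually.of_forall hC)

lemma memLp_test (hV : IsUnitCell Y V) {φ : Space d → ℝ} (hφ : IsTest Y φ) :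
    MemLp φ 2 (cellMeasure V) := hV.memLp_of_bound hφ.continuous hφ.exists_bound

lemma memLp_pderiv (hV : IsUnitCell Y V) {φ : Space d → ℝ} (hφ : IsTest Y φ) (j : Fin d) :
    MemLp (pderiv j φ) 2 (cellMeasure V) :=
  hV.memLp_of_bound (hφ.continuous_pderiv j) (hφ.exists_bound_pderiv j)

lemma memLp_one (hV : IsUnitCell Y V) : MemLp (fun _ => (1 : ℝ)) 2 (cellMeasure V) :=
  hV.memLp_of_bound continuous_const ⟨1, by simp⟩

lemma integral_eq_zero_iff (hV : IsUnitCell Y V) {s : TensorField d}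
    (hs : MemLp s 2 (cellMeasure V)) : ∫ x, s x ∂cellMeasure V = 0 ↔
      ∀ i j, ∫ x, entry i j (s x) ∂cellMeasure V = 0 := by
  have := hV.isProbabilityMeasure
  have h := fun i j => (entry i j).integral_comp_comm (hs.integrable one_le_two)
  simp_rw [h]
  exact ⟨fun h i j => by rw [h, map_zero], fun h => ext_entry fun i j => by rw [h, map_zero]⟩

/-- The self-equilibrated fields on the cell, as a subspace of `L²`. -/
def selfEquilibratedLp (hV : IsUnitCell Y V) : Submodule ℝ (Lp (SymTensor d) 2 (cellMeasure V)) :=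
  (⨅ i : Fin d, ⨅ φ : {φ : Space d → ℝ // IsTest Y φ},
    (∑ j, moment (hV.memLp_pderiv φ.2 j) (entry i j)).ker) ⊓
  ⨅ i : Fin d, ⨅ j : Fin d, (moment hV.memLp_one (entry i j)).ker

lemma isClosed_selfEquilibratedLp (hV : IsUnitCell Y V) :
    IsClosed (hV.selfEquilibratedLp : Set (Lp (SymTensor d) 2 (cellMeasure V))) := by
  simp only [selfEquilibratedLp, Submodule.coe_inf, Submodule.coe_iInf]
  refine IsClosed.inter ?_ ?_
  · exact isClosed_iInter fun i => isClosed_iInter fun φ => ContinuousLinearMap.isClosed_ker _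
  · exact isClosed_iInter fun i => isClosed_iInter fun φ => ContinuousLinearMap.isClosed_ker _

/-- Dictionary between periodic fields and `L²` classes on the cell: the defining conditions of
`S_0` only involve integrals over `V`. -/
lemma mem_selfEquilibratedFields_iff (hV : IsUnitCell Y V) {s : TensorField d}
    (hs : s ∈ tensorFields Y V) {u : Lp (SymTensor d) 2 (cellMeasure V)}
    (hu : u =ᵐ[cellMeasure V] s) :
    s ∈ selfEquilibratedFields Y V ↔ u ∈ hV.selfEquilibratedLp := by
  have hs' : MemLp s 2 (cellMeasure V) := hV.memLp_iff.2 hs.1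
  unfold selfEquilibratedFields selfEquilibratedLp
  rw [Set.mem_ofPred_eq, and_iff_right hs, Submodule.mem_inf]
  simp only [Submodule.mem_iInf]
  refine and_congr ?_ ?_
  · simp only [Subtype.forall]
    refine forall_congr' fun i => forall₂_congr fun φ hφ => ?_
    rw [LinearMap.mem_ker, hV.setIntegral_eq_smul,
      smul_eq_zero_iff_right hV.volume_toReal_ne_zero, integral_finsetSum]
    · simp only [ContinuousLinearMap.coe_coe, _root_.sum_apply, moment_apply]
      refine Eq.congr_left (Finset.sum_congr rfl fun j _ => integral_congr_ae ?_)
      filter_upwards [hu] with x hx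
      rw [hx]; rfl
    · intro j _
      obtain ⟨C, hC⟩ := hφ.exists_bound_pderiv j
      exact hV.integrable_mul ((entry i j).comp_memLp' hs') (hφ.continuous_pderiv j) hC
  · rw [setAverage_eq_integral_cellMeasure, hV.integral_eq_zero_iff hs']
    refine forall₂_congr fun i j => ?_
    rw [LinearMap.mem_ker, ContinuousLinearMap.coe_coe, moment_apply]
    refine Eq.congr_left (integral_congr_ae ?_)
    filter_upwards [hu] with x hx
    rw [hx, mul_one]

end IsUnitCell

end

/-! ### Korn's inequality and compatible fields as a closed subspace -/

section

/-- A bounded operator maps a closed subspace on which it is bounded below to a closed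
subspace. -/
lemma isClosed_map_of_bound {E F : Type*} [NormedAddCommGroup E] [NormedSpace ℝ E]
    [CompleteSpace E] [NormedAddCommGroup F] [NormedSpace ℝ F] (T : E →L[ℝ] F)
    (X : Submodule ℝ E) (hX : IsClosed (X : Set E)) {C : ℝ}
    (h : ∀ x ∈ X, ‖x‖ ≤ C * ‖T x‖) : IsClosed (X.map (T : E →ₗ[ℝ] F) : Set F) := by
  have : CompleteSpace X := hX.completeSpace_coe
  have hanti : AntilipschitzWith C.toNNReal (T.comp X.subtypeL) :=
    (T.comp X.subtypeL).antilipschitz_of_bound fun x =>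
      (h x x.2).trans (mul_le_mul_of_nonneg_right (Real.le_coe_toNNReal C) (norm_nonneg _))
  have := hanti.isClosed_range (T.comp X.subtypeL).uniformContinuous
  convert this using 1
  ext y
  simp

variable {Y : Module.Basis (Fin d) ℝ (Space d)} {V : Set (Space d)}

/-- A component of a vector, as a continuous linear functional. -/
abbrev component {ι : Type*} (i : ι) : EuclideanSpace ℝ ι →L[ℝ] ℝ := EuclideanSpace.proj i

/-- The values of a vector field (left summand) and of its gradient (right summand). -/
abbrev Jet (d : ℕ) : Type := EuclideanSpace ℝ (Fin d ⊕ Fin d × Fin d)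

/-- The symmetric part of the gradient. -/
def jetStrain (d : ℕ) : Jet d →L[ℝ] SymTensor d :=
  LinearMap.toContinuousLinearMap
    { toFun := fun m => ⟨WithLp.toLp 2 fun p => (m (Sum.inr p) + m (Sum.inr p.swap)) / 2,
        fun i j => by simp [add_comm]⟩
      map_add' := fun a b => by ext p; simp; ring
      map_smul' := fun c a => by ext p; simp; ring }

@[simp] lemma entry_jetStrain (i j : Fin d) (m : Jet d) :
    entry i j (jetStrain d m) = (m (Sum.inr (i, j)) + m (Sum.inr (j, i))) / 2 := rfl

namespace IsUnitCell

/-- The pairs of a mean-free periodic displacement and its weak gradient, as a subspace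
of `L² × L²`. -/
def displacementLp (hV : IsUnitCell Y V) :
    Submodule ℝ (Lp (Jet d) 2 (cellMeasure V)) :=
  (⨅ i : Fin d, ⨅ j : Fin d, ⨅ φ : {φ : Space d → ℝ // IsTest Y φ},
    (moment (hV.memLp_pderiv φ.2 j) (component (Sum.inl i)) +
      moment (hV.memLp_test φ.2) (component (Sum.inr (i, j)))).ker) ⊓
  ⨅ i : Fin d,
    (moment hV.memLp_one (component (Sum.inl i))).ker

lemma isClosed_displacementLp (hV : IsUnitCell Y V) :
    IsClosed (hV.displacementLp : Set (Lp (Jet d) 2 (cellMeasure V))) := by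
  simp only [displacementLp, Submodule.coe_inf, Submodule.coe_iInf]
  refine IsClosed.inter ?_ ?_
  · exact isClosed_iInter fun i => isClosed_iInter fun j => isClosed_iInter fun φ =>
      ContinuousLinearMap.isClosed_ker _
  · exact isClosed_iInter fun i => ContinuousLinearMap.isClosed_ker _

lemma mem_displacementLp_iff (hV : IsUnitCell Y V)
    {z : Lp (Jet d) 2 (cellMeasure V)}
    {w : Fin d → Space d → ℝ} {G : Fin d → Fin d → Space d → ℝ}
    (hw : ∀ i, w i =ᵐ[cellMeasure V] fun x => z x (Sum.inl i))
    (hG : ∀ i j, G i j =ᵐ[cellMeasure V] fun x => z x (Sum.inr (i, j))) :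
    z ∈ hV.displacementLp ↔ (∀ i j, HasWeakPDeriv Y V j (w i) (G i j)) ∧
      ∀ i, ∫ x, w i x ∂cellMeasure V = 0 := by
  unfold displacementLp
  rw [Submodule.mem_inf]
  simp only [Submodule.mem_iInf]
  refine and_congr ?_ ?_
  · refine forall₂_congr fun i j => ?_
    rw [hV.hasWeakPDeriv_iff]
    simp only [Subtype.forall]
    refine forall₂_congr fun φ hφ => ?_
    rw [LinearMap.mem_ker, eq_neg_iff_add_eq_zero]
    simp only [ContinuousLinearMap.coe_coe, _root_.add_apply,
      moment_apply]
    refine Eq.congr_left (congrArg₂ _ (integral_congr_ae ?_) (integral_congr_ae ?_))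
    · filter_upwards [hw i] with x hx
      rw [hx]; rfl
    · filter_upwards [hG i j] with x hx
      rw [hx]; rfl
  · refine forall_congr' fun i => ?_
    rw [LinearMap.mem_ker]
    simp only [ContinuousLinearMap.coe_coe, moment_apply]
    refine Eq.congr_left (integral_congr_ae ?_)
    filter_upwards [hw i] with x hx
    rw [hx, mul_one]; rfl

lemma memLp_component {ι : Type*} [Fintype ι] {μ : Measure (Space d)}
    (u : Lp (EuclideanSpace ℝ ι) 2 μ) (i : ι) : MemLp (fun x => u x i) 2 μ :=
  (component i).comp_memLp' (Lp.memLp u)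

lemma norm_sq_eq_sum_integral {ι : Type*} [Fintype ι] {μ : Measure (Space d)}
    (u : Lp (EuclideanSpace ℝ ι) 2 μ) : ‖u‖ ^ 2 = ∑ i, ∫ x, u x i * u x i ∂μ := by
  rw [norm_sq_eq_integral, ← integral_finsetSum]
  · simp_rw [EuclideanSpace.norm_sq_eq, Real.norm_eq_abs, sq_abs, sq]
  · exact fun i _ => (memLp_component u i).integrable_mul (memLp_component u i)

/-- The linearized strain of a displacement with its gradient. -/
def strainLp (V : Set (Space d)) : Lp (Jet d) 2 (cellMeasure V) →L[ℝ]
    Lp (SymTensor d) 2 (cellMeasure V) :=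
  (jetStrain d).compLpL 2 (cellMeasure V)

lemma coeFn_strainLp (z : Lp (Jet d) 2 (cellMeasure V)) :
    strainLp V z =ᵐ[cellMeasure V] fun x => jetStrain d (z x) :=
  (jetStrain d).coeFn_compLpL z

/-- Korn's inequality for periodic fields. -/
lemma korn (hV : IsUnitCell Y V) {z : Lp (Jet d) 2 (cellMeasure V)} (hz : z ∈ hV.displacementLp) :
    ∑ i, ∑ j, ∫ x, z x (Sum.inr (i, j)) * z x (Sum.inr (i, j)) ∂cellMeasure V
      ≤ 2 * ‖strainLp V z‖ ^ 2 := by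
  obtain ⟨hw, -⟩ := (hV.mem_displacementLp_iff (fun i => Filter.EventuallyEq.rfl)
    (fun i j => Filter.EventuallyEq.rfl)).1 hz
  set G : Fin d → Fin d → Space d → ℝ := fun i j x => z x (Sum.inr (i, j)) with hGdef
  have hG : ∀ i j, MemLp (G i j) 2 (cellMeasure V) := fun i j => memLp_component z (Sum.inr (i, j))
  have hint : ∀ i j k l, Integrable (fun x => G i j x * G k l x) (cellMeasure V) :=
    fun i j k l => (hG i j).integrable_mul (hG k l)
  -- Expanding the square of the symmetric part leaves half the squared gradient plus the cross term
  -- of the gradient with its transpose.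
  have e1 : ‖strainLp V z‖ ^ 2 = ∑ i, ∑ j, ((1 / 2) * ∫ x, G i j x * G i j x ∂cellMeasure V) +
      ∑ i, ∑ j, (1 / 2) * ∫ x, G i j x * G j i x ∂cellMeasure V := by
    have : ∀ x, ‖jetStrain d (z x)‖ ^ 2 = ∑ i, ∑ j, ((1 / 4) * (G i j x * G i j x)
        + (1 / 4) * (G j i x * G j i x) + (1 / 2) * (G i j x * G j i x)) := by
      intro x
      rw [← real_inner_self_eq_norm_sq, inner_eq_sum_entry]
      refine Finset.sum_congr rfl fun i _ => Finset.sum_congr rfl fun j _ => ?_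
      rw [entry_jetStrain]; simp only [hGdef]; ring
    rw [norm_sq_eq_integral]
    have e : ∫ x, ‖strainLp V z x‖ ^ 2 ∂cellMeasure V
        = ∫ x, ∑ i, ∑ j, ((1 / 4) * (G i j x * G i j x)
        + (1 / 4) * (G j i x * G j i x) + (1 / 2) * (G i j x * G j i x)) ∂cellMeasure V := by
      refine integral_congr_ae ?_
      filter_upwards [coeFn_strainLp z] with x hx
      rw [hx, this]
    have i3 : ∀ i j, Integrable (fun x => (1 / 4) * (G i j x * G i j x)
        + (1 / 4) * (G j i x * G j i x) + (1 / 2) * (G i j x * G j i x)) (cellMeasure V) :=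
      fun i j => (((hint i j i j).const_mul _).add ((hint j i j i).const_mul _)).add
        ((hint i j j i).const_mul _)
    rw [e, integral_finsetSum _ fun i _ => integrable_finsetSum _ fun j _ => i3 i j]
    have e2 : ∀ i, ∫ x, ∑ j, ((1 / 4) * (G i j x * G i j x)
        + (1 / 4) * (G j i x * G j i x) + (1 / 2) * (G i j x * G j i x)) ∂cellMeasure V
        = ∑ j, ((1 / 4) * ∫ x, G i j x * G i j x ∂cellMeasure V)
        + ∑ j, ((1 / 4) * ∫ x, G j i x * G j i x ∂cellMeasure V)
        + ∑ j, ((1 / 2) * ∫ x, G i j x * G j i x ∂cellMeasure V) := by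
      intro i
      rw [integral_finsetSum _ fun j _ => i3 i j, ← Finset.sum_add_distrib,
        ← Finset.sum_add_distrib]
      refine Finset.sum_congr rfl fun j _ => ?_
      refine (integral_add (((hint i j i j).const_mul _).add ((hint j i j i).const_mul _))
        ((hint i j j i).const_mul _)).trans ?_
      refine (congrArg (· + _) (integral_add ((hint i j i j).const_mul _)
        ((hint j i j i).const_mul _))).trans ?_
      simp only [integral_const_mul]
    simp_rw [e2, Finset.sum_add_distrib]
    rw [Finset.sum_comm (f := fun i j => (1 / 4) * ∫ x, G j i x * G j i x ∂cellMeasure V)]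
    simp_rw [← Finset.mul_sum]
    ring
  -- By `integral_grad_mul_transpose` the cross term is half the integral of the squared divergence.
  have e2 : 0 ≤ ∑ i, ∑ j, (1 / 2) * ∫ x, G i j x * G j i x ∂cellMeasure V := by
    rw [Finset.sum_congr rfl fun i _ => Finset.sum_congr rfl fun j _ =>
      congrArg _ (hV.integral_grad_mul_transpose hG hw i j)]
    simp_rw [← Finset.mul_sum]
    refine mul_nonneg (by norm_num) ?_
    have : ∑ i, ∑ j, ∫ x, G i i x * G j j x ∂cellMeasure V
        = ∫ x, (∑ i, G i i x) * (∑ j, G j j x) ∂cellMeasure V := by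
      simp_rw [Finset.sum_mul_sum]
      rw [integral_finsetSum _ fun i _ => integrable_finsetSum _ fun j _ => hint i i j j]
      refine Finset.sum_congr rfl fun i _ => ?_
      rw [integral_finsetSum _ fun j _ => hint i i j j]
    rw [this]
    exact integral_nonneg fun x => mul_self_nonneg _
  change ∑ i, ∑ j, ∫ x, G i j x * G i j x ∂cellMeasure V ≤ _
  rw [e1]
  simp_rw [← Finset.mul_sum] at e2 ⊢
  linarith

/-- The `1` accounts for the gradient entries of the jet, the sum for the displacement entries,
bounded componentwise by `poincare`. -/
lemma poincare_displacement (hV : IsUnitCell Y V) {z : Lp (Jet d) 2 (cellMeasure V)} (hz : z ∈ hV.displacementLp) :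
    ‖z‖ ^ 2 ≤ (1 + ∑ l, ‖Y l‖ ^ 2) *
      ∑ i, ∑ j, ∫ x, z x (Sum.inr (i, j)) * z x (Sum.inr (i, j)) ∂cellMeasure V := by
  obtain ⟨hw, h0⟩ := (hV.mem_displacementLp_iff (fun i => Filter.EventuallyEq.rfl)
    (fun i j => Filter.EventuallyEq.rfl)).1 hz
  rw [norm_sq_eq_sum_integral, Fintype.sum_sum_type, Fintype.sum_prod_type, add_mul, one_mul,
    add_comm]
  refine add_le_add_right ?_ _
  rw [Finset.mul_sum]
  exact Finset.sum_le_sum fun i _ => hV.poincare (memLp_component z (Sum.inl i))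
    (fun j => memLp_component z (Sum.inr (i, j))) (hw i) (h0 i)

/-- The compatible fields on the cell, as a subspace of `L²`. -/
def compatibleLp (hV : IsUnitCell Y V) : Submodule ℝ (Lp (SymTensor d) 2 (cellMeasure V)) :=
  hV.displacementLp.map (strainLp V : _ →ₗ[ℝ] Lp (SymTensor d) 2 (cellMeasure V))

/-- On mean-free displacements Poincaré and Korn bound the jet by its strain, so the strain map has
closed image. The normalisation of the mean removes the rigid translations from the kernel. -/
lemma isClosed_compatibleLp (hV : IsUnitCell Y V) :
    IsClosed (hV.compatibleLp : Set (Lp (SymTensor d) 2 (cellMeasure V))) := by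
  set C : ℝ := 1 + ∑ l, ‖Y l‖ ^ 2 with hC
  have hS : 0 ≤ ∑ l, ‖Y l‖ ^ 2 := Finset.sum_nonneg fun _ _ => by positivity
  have hbound : ∀ z ∈ hV.displacementLp, ‖z‖ ≤ 2 * C * ‖strainLp V z‖ := by
    intro z hz
    refine abs_le_of_sq_le_sq' ?_ (by positivity) |>.2
    calc ‖z‖ ^ 2 ≤ C * ∑ i, ∑ j,
          ∫ x, z x (Sum.inr (i, j)) * z x (Sum.inr (i, j)) ∂cellMeasure V :=
          hV.poincare_displacement hz
      _ ≤ C * (2 * ‖strainLp V z‖ ^ 2) := mul_le_mul_of_nonneg_left (hV.korn hz) (by positivity)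
      -- As `C ≥ 1`, `2C ≤ (2C)²`; the cruder constant avoids a square root.
      _ ≤ (2 * C * ‖strainLp V z‖) ^ 2 := by
        rw [mul_pow, ← mul_assoc]
        refine mul_le_mul_of_nonneg_right ?_ (by positivity)
        nlinarith
  exact isClosed_map_of_bound (E := Lp (Jet d) 2 (cellMeasure V))
    (F := Lp (SymTensor d) 2 (cellMeasure V)) (strainLp V) hV.displacementLp
    hV.isClosed_displacementLp (C := 2 * C) hbound

lemma mem_compatibleLp (hV : IsUnitCell Y V) {e : TensorField d}
    (he : e ∈ compatibleFields Y V) {u : Lp (SymTensor d) 2 (cellMeasure V)}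
    (hu : u =ᵐ[cellMeasure V] e) : u ∈ hV.compatibleLp := by
  have := hV.isProbabilityMeasure
  obtain ⟨-, w, G, ⟨hw, hG⟩, hsym⟩ := he
  have hw' : ∀ i, MemLp (w i) 2 (cellMeasure V) := fun i => hV.memLp_iff.2 (hw i).1
  have hG' : ∀ i j, MemLp (G i j) 2 (cellMeasure V) := fun i j => hV.memLp_iff.2 (hG i j).1.1
  -- Subtracting the mean keeps the weak gradient, because derivatives of test functions have zero
  -- average.
  set m : Fin d → ℝ := fun i => ∫ x, w i x ∂cellMeasure V with hm
  have hwm : ∀ i, MemLp (fun x => w i x - m i) 2 (cellMeasure V) :=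
    fun i => (hw' i).sub (memLp_const _)
  have hJ : MemLp (fun x => (WithLp.toLp 2
      (Sum.elim (fun i => w i x - m i) fun p => G p.1 p.2 x) : Jet d)) 2 (cellMeasure V) :=
    MemLp.of_eval_piLp fun p => p.rec hwm fun p => hG' p.1 p.2
  have hz : hJ.toLp _ ∈ hV.displacementLp := by
    rw [hV.mem_displacementLp_iff (w := fun i x => w i x - m i) (G := G)]
    · refine ⟨fun i j => ?_, fun i => ?_⟩
      · rw [hV.hasWeakPDeriv_iff]
        intro φ hφ
        obtain ⟨C, hC⟩ := hφ.exists_bound_pderiv j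
        have h1 := hV.hasWeakPDeriv_iff.1 (hG i j).2 φ hφ
        rw [← h1]
        simp_rw [sub_mul]
        rw [integral_sub (hV.integrable_mul (hw' i) (hφ.continuous_pderiv j) hC)
          (hV.integrable_mul (memLp_const _) (hφ.continuous_pderiv j) hC), integral_const_mul, hV.integral_pderiv hφ]
        simp
      · rw [integral_sub ((hw' i).integrable one_le_two) (integrable_const _)]
        simp [hm]
    · intro i
      filter_upwards [hJ.coeFn_toLp] with x hx
      simp [hx]
    · intro i j
      filter_upwards [hJ.coeFn_toLp] with x hx
      simp [hx]
  refine ⟨_, hz, ?_⟩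
  refine Lp.ext ?_
  have hsym' : ∀ᵐ x ∂cellMeasure V, ∀ i j, entry i j (e x) = (G i j x + G j i x) / 2 := by
    rw [hV.ae_cellMeasure_iff]
    exact ae_restrict_of_ae (ae_all_iff.2 fun i => ae_all_iff.2 fun j => hsym i j)
  filter_upwards [coeFn_strainLp (hJ.toLp _), hJ.coeFn_toLp, hu, hsym'] with x h1 h2 h3 h4
  simp only [ContinuousLinearMap.coe_coe]
  rw [h1, h3, h2]
  refine ext_entry fun i j => ?_
  rw [h4, entry_jetStrain]
  rfl

lemma exists_mem_compatibleFields (hV : IsUnitCell Y V)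
    {u : Lp (SymTensor d) 2 (cellMeasure V)} (hu : u ∈ hV.compatibleLp) :
    ∃ e ∈ compatibleFields Y V, e =ᵐ[cellMeasure V] u := by
  obtain ⟨z, hz, rfl⟩ := hu
  obtain ⟨e, he, hez⟩ := hV.exists_mem_L2per (Lp.memLp (strainLp V z))
  choose w hw hwz using fun i => hV.exists_mem_L2per (memLp_component z (Sum.inl i))
  choose G hG hGz using fun i j => hV.exists_mem_L2per (memLp_component z (Sum.inr (i, j)))
  refine ⟨e, ⟨he, w, G, ⟨hw, fun i j => ⟨hG i j, ?_⟩⟩, fun i j => ?_⟩, hez⟩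
  · exact ((hV.mem_displacementLp_iff hwz hGz).1 hz).1 i j
  -- The periodic representatives `e` and `G` were chosen independently, so their relation is known
  -- only on the cell and is carried to the whole space by periodicity.
  · have := hV.ae_eq_of_ae_eq_cellMeasure (f := fun x => entry i j (e x))
      (g := fun x => (G i j x + G j i x) / 2) ?_ ?_ ?_
    · exact this
    · intro y hy
      filter_upwards [he.2 y hy] with x hx
      rw [hx]
    · intro y hy
      filter_upwards [(hG i j).2 y hy, (hG j i).2 y hy] with x h1 h2
      rw [h1, h2]
    · filter_upwards [hez, coeFn_strainLp z, hGz i j, hGz j i] with x h1 h2 h3 h4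
      rw [h1, h2, h3, h4, entry_jetStrain]

end IsUnitCell

end

/-! ### Coercivity and inversion of tensors, energetic scalar products -/

section

variable {Y : Module.Basis (Fin d) ℝ (Space d)} {V : Set (Space d)} {A : Tensor4 d}

/-- A positive definite operator on a finite-dimensional space is coercive. -/
lemma exists_coercive_of_pos {E : Type*} [NormedAddCommGroup E] [InnerProductSpace ℝ E]
    [FiniteDimensional ℝ E] (A : E →L[ℝ] E) (hA : ∀ e : E, e ≠ 0 → 0 < ⟪A e, e⟫_ℝ) :
    ∃ α : ℝ, 0 < α ∧ ∀ e : E, α * ‖e‖ ^ 2 ≤ ⟪A e, e⟫_ℝ := by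
  -- In the zero space the unit sphere is empty and there is no minimiser to take as the constant.
  rcases subsingleton_or_nontrivial E with h | h
  · exact ⟨1, one_pos, fun e => by simp [Subsingleton.elim e 0]⟩
  have := FiniteDimensional.proper_real E
  obtain ⟨e₀, he₀, hmin⟩ := (isCompact_sphere (0 : E) 1).exists_isMinOn
    (NormedSpace.sphere_nonempty.2 zero_le_one) (f := fun e => ⟪A e, e⟫_ℝ) (by fun_prop)
  have h0 : e₀ ≠ 0 := by
    rintro rfl
    simp at he₀
  refine ⟨⟪A e₀, e₀⟫_ℝ, hA _ h0, fun e => ?_⟩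
  by_cases hne : e = 0
  · simp [hne]
  have hn : ‖e‖ ≠ 0 := norm_ne_zero_iff.2 hne
  have hs : (‖e‖⁻¹ • e) ∈ Metric.sphere (0 : E) 1 := by
    simp [norm_smul, hn]
  have := isMinOn_iff.1 hmin _ hs
  simp only [map_smul, inner_smul_left, inner_smul_right, RCLike.conj_to_real] at this
  calc _ ≤ (‖e‖⁻¹ * (‖e‖⁻¹ * ⟪A e, e⟫_ℝ)) * ‖e‖ ^ 2 := by gcongr
    _ = _ := by field_simp

/-- Inversion in a Banach algebra, extended by zero, is a Borel function. -/
lemma measurable_ringInverse (R : Type*) [NormedRing R] [CompleteSpace R] [MeasurableSpace R]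
    [BorelSpace R] : Measurable (Ring.inverse : R → R) := by
  classical
  have h : ContinuousOn (Ring.inverse : R → R) {A | IsUnit A} := by
    rintro _ ⟨u, rfl⟩
    exact (NormedRing.inverse_continuousAt u).continuousWithinAt
  have hU : MeasurableSet {A : R | IsUnit A} := Units.isOpen.measurableSet
  have := h.measurable_piecewise (g := fun _ => (0 : R)) continuousOn_const hU
  convert this using 1
  ext1 A
  by_cases hA : A ∈ {A : R | IsUnit A}
  · rw [Set.piecewise_eq_of_mem _ _ _ hA]
  · rw [Set.piecewise_eq_of_notMem _ _ _ hA, Ring.inverse_non_unit _ hA]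

/-- Tensors that are coercive are invertible. -/
lemma isInvertible_of_pos (h : ∀ e : SymTensor d, e ≠ 0 → 0 < ⟪A e, e⟫_ℝ) : A.IsInvertible := by
  have hinj : Function.Injective (A : SymTensor d →ₗ[ℝ] SymTensor d) := by
    rw [injective_iff_map_eq_zero]
    intro e he
    by_contra hne
    have := h e hne
    rw [ContinuousLinearMap.coe_coe] at he
    simp [he] at this
  exact ⟨(LinearEquiv.ofInjectiveEndo _ hinj).toContinuousLinearEquiv, by ext; rfl⟩

namespace IsElasticityTensor

lemma isInvertible (hA : IsElasticityTensor A) : A.IsInvertible := isInvertible_of_pos hA.pos_def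

lemma inverse (hA : IsElasticityTensor A) : IsElasticityTensor A.inverse := by
  have hinv := hA.isInvertible
  refine ⟨fun e f => ?_, fun e he => ?_⟩
  · conv_lhs => rw [← hinv.self_apply_inverse f]
    conv_rhs => rw [← hinv.self_apply_inverse e]
    rw [hA.major_symm]
  · have hne : A.inverse e ≠ 0 := by
      intro h0
      apply he
      rw [← hinv.self_apply_inverse e, h0, map_zero]
    have := hA.pos_def _ hne
    rwa [hinv.self_apply_inverse, real_inner_comm] at this

lemma exists_coercive (hA : IsElasticityTensor A) :
    ∃ α : ℝ, 0 < α ∧ ∀ e : SymTensor d, α * ‖e‖ ^ 2 ≤ ⟪A e, e⟫_ℝ :=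
  exists_coercive_of_pos A hA.pos_def

end IsElasticityTensor

lemma measurable_inverse : Measurable fun A : Tensor4 d => A.inverse := by
  rw [← ContinuousLinearMap.ringInverse_eq_inverse]
  exact measurable_ringInverse (Tensor4 d)

lemma integrable_inner_of_memLp {μ : Measure (Space d)} {f g : TensorField d} (hf : MemLp f 2 μ)
    (hg : MemLp g 2 μ) : Integrable (fun x => ⟪f x, g x⟫_ℝ) μ := by
  refine (L2.integrable_inner (𝕜 := ℝ) (hf.toLp f) (hg.toLp g)).congr ?_
  filter_upwards [hf.coeFn_toLp, hg.coeFn_toLp] with x h1 h2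
  rw [h1, h2]

lemma memLp_apply {μ : Measure (Space d)} {L : Space d → Tensor4 d} {f : TensorField d}
    (hL : AEStronglyMeasurable L μ) {M : ℝ} (hM : ∀ᵐ x ∂μ, ‖L x‖ ≤ M) (hf : MemLp f 2 μ) :
    MemLp (fun x => L x (f x)) 2 μ := by
  refine MemLp.of_le_mul (c := M) hf
    (isBoundedBilinearMap_apply.continuous.comp_aestronglyMeasurable
      (hL.prodMk hf.aestronglyMeasurable)) ?_
  filter_upwards [hM] with x hx
  exact (L x).le_of_opNorm_le hx _

lemma strainProd_eq_integral (V : Set (Space d)) (A : Tensor4 d) (η η' : TensorField d) :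
    strainProd V A η η' = ∫ x, ⟪A (η x), η' x⟫_ℝ ∂cellMeasure V := rfl

/-- Since `A⁻¹` is again an elasticity tensor, everything proved for the strain product serves for
stresses too. -/
lemma IsElasticityTensor.stressProd_eq (hA : IsElasticityTensor A) :
    stressProd V A = strainProd V A.inverse := by
  ext τ τ'
  unfold stressProd strainProd
  simp_rw [hA.inverse.major_symm]

lemma integrable_strainProd {μ : Measure (Space d)} (A : Tensor4 d) {f g : TensorField d}
    (hf : MemLp f 2 μ) (hg : MemLp g 2 μ) : Integrable (fun x => ⟪A (f x), g x⟫_ℝ) μ :=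
  integrable_inner_of_memLp (A.comp_memLp' hf) hg

lemma strainProd_sub_left (A : Tensor4 d) {f f' g : TensorField d}
    (hf : MemLp f 2 (cellMeasure V)) (hf' : MemLp f' 2 (cellMeasure V))
    (hg : MemLp g 2 (cellMeasure V)) :
    strainProd V A (f - f') g = strainProd V A f g - strainProd V A f' g := by
  simp_rw [strainProd_eq_integral, Pi.sub_apply, map_sub, inner_sub_left]
  exact integral_sub (integrable_strainProd A hf hg) (integrable_strainProd A hf' hg)

lemma strainProd_add_right (A : Tensor4 d) {f g g' : TensorField d}
    (hf : MemLp f 2 (cellMeasure V)) (hg : MemLp g 2 (cellMeasure V))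
    (hg' : MemLp g' 2 (cellMeasure V)) :
    strainProd V A f (g + g') = strainProd V A f g + strainProd V A f g' := by
  simp_rw [strainProd_eq_integral, Pi.add_apply, inner_add_right]
  exact integral_add (integrable_strainProd A hf hg) (integrable_strainProd A hf hg')

lemma strainProd_sub_right (A : Tensor4 d) {f g g' : TensorField d}
    (hf : MemLp f 2 (cellMeasure V)) (hg : MemLp g 2 (cellMeasure V))
    (hg' : MemLp g' 2 (cellMeasure V)) :
    strainProd V A f (g - g') = strainProd V A f g - strainProd V A f g' := by
  simp_rw [strainProd_eq_integral, Pi.sub_apply, inner_sub_right]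
  exact integral_sub (integrable_strainProd A hf hg) (integrable_strainProd A hf hg')

lemma IsElasticityTensor.strainProd_comm (hA : IsElasticityTensor A) (f g : TensorField d) :
    strainProd V A f g = strainProd V A g f := by
  simp_rw [strainProd_eq_integral]
  refine integral_congr_ae (Filter.Eventually.of_forall fun x => ?_)
  exact (hA.major_symm _ _).trans (real_inner_comm _ _)

lemma strainProd_congr (A : Tensor4 d) {f f' g g' : TensorField d}
    (hf : f =ᵐ[cellMeasure V] f') (hg : g =ᵐ[cellMeasure V] g') :
    strainProd V A f g = strainProd V A f' g' := by
  simp_rw [strainProd_eq_integral]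
  refine integral_congr_ae ?_
  filter_upwards [hf, hg] with x h1 h2
  rw [h1, h2]

lemma ae_eq_zero_of_strainProd_self (hA : IsElasticityTensor A) {f : TensorField d}
    (hf : MemLp f 2 (cellMeasure V)) (h : strainProd V A f f = 0) : f =ᵐ[cellMeasure V] 0 := by
  obtain ⟨α, hα, hco⟩ := hA.exists_coercive
  rw [strainProd_eq_integral, integral_eq_zero_iff_of_nonneg
    (fun x => (mul_nonneg hα.le (sq_nonneg _)).trans (hco _)) (integrable_strainProd A hf hf)] at h
  filter_upwards [h] with x hx
  have := hco (f x)
  rw [hx] at this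
  have h2 : ‖f x‖ ^ 2 ≤ 0 := by
    rw [Pi.zero_apply] at this
    exact nonpos_of_mul_nonpos_right this hα
  simpa using h2

/-- Orthogonal projections are unique up to null sets. -/
lemma IsOrthProj.ae_eq (hA : IsElasticityTensor A) {K : Set (TensorField d)}
    (hK : ∀ k ∈ K, MemLp k 2 (cellMeasure V)) {f p p' : TensorField d}
    (hf : MemLp f 2 (cellMeasure V)) (hp : IsOrthProj (strainProd V A) K f p)
    (hp' : IsOrthProj (strainProd V A) K f p') : p =ᵐ[cellMeasure V] p' := by
  have h1 := hK p hp.1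
  have h1' := hK p' hp'.1
  have key : ∀ k ∈ K, strainProd V A (p - p') k = 0 := by
    intro k hk
    have e1 := hp.2 k hk
    have e2 := hp'.2 k hk
    rw [strainProd_sub_left A hf h1 (hK k hk)] at e1
    rw [strainProd_sub_left A hf h1' (hK k hk)] at e2
    rw [strainProd_sub_left A h1 h1' (hK k hk)]
    linarith
  have h0 : strainProd V A (p - p') (p - p') = 0 := by
    rw [strainProd_sub_right A (h1.sub h1') h1 h1', key p hp.1, key p' hp'.1, sub_zero]
  filter_upwards [ae_eq_zero_of_strainProd_self hA (h1.sub h1') h0] with x hx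
  exact sub_eq_zero.1 hx

lemma isOrthProj_orthProj {B : TensorField d → TensorField d → ℝ} {K : Set (TensorField d)}
    {f : TensorField d} (h : ∃ p, IsOrthProj B K f p) : IsOrthProj B K f (orthProj B K f) :=
  Classical.epsilon_spec h

lemma IsUnitCell.memLp_of_mem (hV : IsUnitCell Y V) {f : TensorField d}
    (hf : f ∈ tensorFields Y V) : MemLp f 2 (cellMeasure V) := hV.memLp_iff.2 hf.1

/-- Projections exist onto sets of fields that represent a closed subspace of `L²`. -/
lemma IsUnitCell.exists_isOrthProj (hV : IsUnitCell Y V) (hA : IsElasticityTensor A)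
    {K : Set (TensorField d)} (hK : ∀ k ∈ K, k ∈ tensorFields Y V)
    {H : Submodule ℝ (Lp (SymTensor d) 2 (cellMeasure V))}
    (hH : IsClosed (H : Set (Lp (SymTensor d) 2 (cellMeasure V))))
    (hKH : ∀ k ∈ K, ∀ u : Lp (SymTensor d) 2 (cellMeasure V), u =ᵐ[cellMeasure V] k → u ∈ H)
    (hHK : ∀ u ∈ H, ∃ k ∈ K, k =ᵐ[cellMeasure V] u) {f : TensorField d}
    (hf : f ∈ tensorFields Y V) : ∃ p, IsOrthProj (strainProd V A) K f p := by
  obtain ⟨α, hα, hco⟩ := hA.exists_coercive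
  have hf' := hV.memLp_of_mem hf
  have hinner : ∀ u v : Lp (SymTensor d) 2 (cellMeasure V),
      ⟪A.compLpL 2 (cellMeasure V) u, v⟫_ℝ = strainProd V A u v := by
    intro u v
    rw [L2.inner_def, strainProd_eq_integral]
    refine integral_congr_ae ?_
    filter_upwards [A.coeFn_compLpL u] with x hx
    rw [hx]
  have hcoer : ∀ u : Lp (SymTensor d) 2 (cellMeasure V),
      α * ‖u‖ ^ 2 ≤ ⟪A.compLpL 2 (cellMeasure V) u, u⟫_ℝ := by
    intro u
    rw [hinner, norm_sq_eq_integral, ← integral_const_mul, strainProd_eq_integral]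
    refine integral_mono ?_ (integrable_strainProd A (Lp.memLp u) (Lp.memLp u)) fun x => hco _
    refine Integrable.const_mul ?_ _
    simp_rw [← real_inner_self_eq_norm_sq]
    exact integrable_inner_of_memLp (Lp.memLp u) (Lp.memLp u)
  obtain ⟨p, hp, hpk⟩ := exists_proj_of_coercive _ hα hcoer H hH (hf'.toLp f)
  obtain ⟨q, hq, hqp⟩ := hHK p hp
  refine ⟨q, hq, fun k hk => ?_⟩
  have hk' := hV.memLp_of_mem (hK k hk)
  rw [← hpk (hk'.toLp k) (hKH k hk _ hk'.coeFn_toLp), hinner]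
  refine strainProd_congr A ?_ hk'.coeFn_toLp.symm
  filter_upwards [hqp, hf'.coeFn_toLp, Lp.coeFn_sub (hf'.toLp f) p] with x h1 h2 h3
  rw [h3, Pi.sub_apply, Pi.sub_apply, h1, h2]

end

/-! ### Admissible components and orthogonality of stresses to compatible strains -/

section

variable {Y : Module.Basis (Fin d) ℝ (Space d)} {V : Set (Space d)} {A : Tensor4 d}

namespace IsUnitCell

lemma const_mem_tensorFields (hV : IsUnitCell Y V) (m : SymTensor d) :
    (fun _ => m : TensorField d) ∈ tensorFields Y V := by
  have := hV.isProbabilityMeasure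
  exact ⟨hV.memLp_iff.1 (memLp_const m), fun _ _ => Filter.Eventually.of_forall fun _ => rfl⟩

lemma add_mem_tensorFields {f g : TensorField d} (hf : f ∈ tensorFields Y V)
    (hg : g ∈ tensorFields Y V) : f + g ∈ tensorFields Y V := by
  refine ⟨hf.1.add hg.1, fun y hy => ?_⟩
  filter_upwards [hf.2 y hy, hg.2 y hy] with x h1 h2
  simp only [Pi.add_apply, h1, h2]

lemma sub_mem_tensorFields {f g : TensorField d} (hf : f ∈ tensorFields Y V)
    (hg : g ∈ tensorFields Y V) : f - g ∈ tensorFields Y V := by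
  refine ⟨hf.1.sub hg.1, fun y hy => ?_⟩
  filter_upwards [hf.2 y hy, hg.2 y hy] with x h1 h2
  simp only [Pi.sub_apply, h1, h2]

lemma mem_tensorFields_of_mem_equilibratedFields {s : TensorField d}
    (hs : s ∈ equilibratedFields Y V) : s ∈ tensorFields Y V := by
  obtain ⟨u, hu, s₀, hs₀, rfl⟩ := hs
  exact add_mem_tensorFields hu.1 hs₀.1

lemma isOrthProj_kinComponent (hV : IsUnitCell Y V) (hA : IsElasticityTensor A)
    {η : TensorField d} (hη : η ∈ tensorFields Y V) :
    IsOrthProj (strainProd V A) (compatibleFields Y V) η (kinComponent Y V A η) :=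
  isOrthProj_orthProj (hV.exists_isOrthProj hA (fun _ hk => hk.1) hV.isClosed_compatibleLp
    (fun _ hk _ hu => hV.mem_compatibleLp hk hu) (fun _ hu => hV.exists_mem_compatibleFields hu) hη)

lemma isOrthProj_selfEquilibrated (hV : IsUnitCell Y V) (hA : IsElasticityTensor A)
    {τ : TensorField d} (hτ : τ ∈ tensorFields Y V) :
    IsOrthProj (stressProd V A) (selfEquilibratedFields Y V) τ
      (orthProj (stressProd V A) (selfEquilibratedFields Y V) τ) := by
  rw [hA.stressProd_eq]
  refine isOrthProj_orthProj (hV.exists_isOrthProj hA.inverse (fun _ hk => hk.1)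
    hV.isClosed_selfEquilibratedLp
    (fun _ hk _ hu => (hV.mem_selfEquilibratedFields_iff hk.1 hu).1 hk) (fun u hu => ?_) hτ)
  obtain ⟨s, hs, hsu⟩ := hV.exists_mem_L2per (Lp.memLp u)
  exact ⟨s, (hV.mem_selfEquilibratedFields_iff hs hsu.symm).2 hu, hsu⟩

lemma integral_inner_const (hV : IsUnitCell Y V) {f : TensorField d}
    (hf : MemLp f 2 (cellMeasure V)) (m : SymTensor d) :
    ∫ x, ⟪f x, m⟫_ℝ ∂cellMeasure V = ⟪∫ x, f x ∂cellMeasure V, m⟫_ℝ := by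
  have := hV.isProbabilityMeasure
  simp_rw [real_inner_comm m]
  exact integral_inner (hf.integrable one_le_two) m

/-- As `A⁻¹` is constant, its product with a uniform field sees only the mean. Uniform and mean-free
fields are therefore orthogonal, and the projections onto the two summands add up. -/
lemma isOrthProj_statComponent (hV : IsUnitCell Y V) (hA : IsElasticityTensor A)
    {τ : TensorField d} (hτ : τ ∈ tensorFields Y V) :
    IsOrthProj (stressProd V A) (equilibratedFields Y V) τ (statComponent Y V A τ) := by
  have := hV.isProbabilityMeasure
  have hp := hV.isOrthProj_selfEquilibrated hA hτ
  unfold statComponent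
  rw [setAverage_eq_integral_cellMeasure]
  set p := orthProj (stressProd V A) (selfEquilibratedFields Y V) τ
  set m : SymTensor d := ∫ x, τ x ∂cellMeasure V with hm
  have hm' := hV.const_mem_tensorFields m
  refine ⟨⟨_, ⟨hm', m, Filter.EventuallyEq.rfl⟩, p, hp.1, rfl⟩, ?_⟩
  rintro _ ⟨u, ⟨hu, n, hn⟩, s₀, hs₀, rfl⟩
  rw [hA.stressProd_eq] at hp ⊢
  have mτ := hV.memLp_of_mem hτ
  have mp := hV.memLp_of_mem hp.1.1
  have mm := hV.memLp_of_mem hm'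
  have mu := hV.memLp_of_mem hu
  have ms := hV.memLp_of_mem hs₀.1
  have mean0 : ∀ {s : TensorField d}, s ∈ selfEquilibratedFields Y V →
      ∫ x, s x ∂cellMeasure V = 0 := fun hs => hs.2.2
  rw [strainProd_add_right _ (mτ.sub (mm.add mp)) mu ms]
  have e1 : strainProd V A.inverse (τ - ((fun _ => m) + p)) s₀ = 0 := by
    have e : strainProd V A.inverse (fun _ => m) s₀ = 0 := by
      rw [hA.inverse.strainProd_comm, strainProd_eq_integral]
      simp_rw [hA.inverse.major_symm]
      rw [hV.integral_inner_const ms, mean0 hs₀, inner_zero_left]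
    rw [add_comm, ← sub_sub, strainProd_sub_left _ (mτ.sub mp) mm ms, hp.2 s₀ hs₀, e, sub_zero]
  have e2 : strainProd V A.inverse (τ - ((fun _ => m) + p)) u = 0 := by
    have hn' : u =ᵐ[cellMeasure V] fun _ => n :=
      hV.ae_cellMeasure_iff.2 (ae_restrict_of_ae hn)
    rw [strainProd_congr _ Filter.EventuallyEq.rfl hn', strainProd_eq_integral]
    simp_rw [hA.inverse.major_symm]
    rw [hV.integral_inner_const (mτ.sub (mm.add mp))]
    have : ∫ x, (τ - ((fun _ => m : TensorField d) + p)) x ∂cellMeasure V = 0 := by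
      simp only [Pi.sub_apply, Pi.add_apply]
      rw [integral_sub (g := fun x => m + p x) (mτ.integrable one_le_two)
        ((mm.add mp).integrable one_le_two), integral_add (mm.integrable one_le_two)
        (mp.integrable one_le_two), mean0 hp.1]
      simp [hm]
    rw [this, inner_zero_left]
  rw [e1, e2, add_zero]

/-- The residual of a projection onto `S` is the projection onto `S^⊥`, so the latter exists without
a separate closedness argument. -/
lemma isOrthProj_sub_statComponent (hV : IsUnitCell Y V) (hA : IsElasticityTensor A)
    {τ : TensorField d} (hτ : τ ∈ tensorFields Y V) :
    IsOrthProj (stressProd V A) (equilibratedOrtho Y V A) τ (τ - statComponent Y V A τ) := by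
  have hs := hV.isOrthProj_statComponent hA hτ
  refine ⟨⟨sub_mem_tensorFields hτ (mem_tensorFields_of_mem_equilibratedFields hs.1), hs.2⟩, ?_⟩
  intro k hk
  rw [sub_sub_cancel]
  have := hk.2 _ hs.1
  rw [hA.stressProd_eq] at this ⊢
  rw [hA.inverse.strainProd_comm, this]

lemma isOrthProj_statOrthoComponent (hV : IsUnitCell Y V) (hA : IsElasticityTensor A)
    {τ : TensorField d} (hτ : τ ∈ tensorFields Y V) :
    IsOrthProj (stressProd V A) (equilibratedOrtho Y V A) τ (statOrthoComponent Y V A τ) :=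
  isOrthProj_orthProj ⟨_, hV.isOrthProj_sub_statComponent hA hτ⟩

/-- The chosen projection is an arbitrary representative; uniqueness up to null sets identifies it
with the explicit residual. -/
lemma statOrthoComponent_ae_eq (hV : IsUnitCell Y V) (hA : IsElasticityTensor A)
    {τ : TensorField d} (hτ : τ ∈ tensorFields Y V) :
    statOrthoComponent Y V A τ =ᵐ[cellMeasure V] τ - statComponent Y V A τ := by
  have h1 := hV.isOrthProj_statOrthoComponent hA hτ
  have h2 := hV.isOrthProj_sub_statComponent hA hτ
  rw [hA.stressProd_eq] at h1 h2
  exact h1.ae_eq hA.inverse (fun k hk => hV.memLp_of_mem hk.1) (hV.memLp_of_mem hτ) h2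

/-- Divergence-free fields are orthogonal to compatible fields. -/
lemma integral_inner_compatible_of_divFree (hV : IsUnitCell Y V) {s e : TensorField d}
    (hs : MemLp s 2 (cellMeasure V)) (hdiv : ∀ (i : Fin d) (φ : Space d → ℝ), IsTest Y φ →
      ∫ x, ∑ j, entry i j (s x) * pderiv j φ x ∂cellMeasure V = 0)
    (he : e ∈ compatibleFields Y V) : ∫ x, ⟪s x, e x⟫_ℝ ∂cellMeasure V = 0 := by
  obtain ⟨-, w, G, ⟨-, hG⟩, hsym⟩ := he
  have hG' : ∀ i j, MemLp (G i j) 2 (cellMeasure V) := fun i j => hV.memLp_iff.2 (hG i j).1.1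
  have hs' : ∀ i j, MemLp (fun x => entry i j (s x)) 2 (cellMeasure V) :=
    fun i j => (entry i j).comp_memLp' hs
  have hint : ∀ i j, Integrable (fun x => entry i j (s x) * G i j x) (cellMeasure V) :=
    fun i j => (hs' i j).integrable_mul (hG' i j)
  have hsym' : ∀ᵐ x ∂cellMeasure V, ∀ i j, entry i j (e x) = (G i j x + G j i x) / 2 := by
    rw [hV.ae_cellMeasure_iff]
    exact ae_restrict_of_ae (ae_all_iff.2 fun i => ae_all_iff.2 fun j => hsym i j)
  have e1 : ∫ x, ⟪s x, e x⟫_ℝ ∂cellMeasure V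
      = ∫ x, ∑ i, ∑ j, entry i j (s x) * G i j x ∂cellMeasure V := by
    refine integral_congr_ae ?_
    filter_upwards [hsym'] with x hx
    rw [inner_eq_sum_entry]
    -- The symmetry of the stress lets the full gradient replace its symmetric part.
    have hcomm : ∑ i, ∑ j, entry i j (s x) * G j i x = ∑ i, ∑ j, entry i j (s x) * G i j x := by
      rw [Finset.sum_comm]
      refine Finset.sum_congr rfl fun i _ => Finset.sum_congr rfl fun j _ => ?_
      rw [show entry j i (s x) = entry i j (s x) from (s x).2 j i]
    calc _ = ∑ i, ∑ j, (1 / 2 * (entry i j (s x) * G i j x)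
          + 1 / 2 * (entry i j (s x) * G j i x)) := by
          refine Finset.sum_congr rfl fun i _ => Finset.sum_congr rfl fun j _ => ?_
          rw [hx]; ring
      _ = _ := by
          simp_rw [Finset.sum_add_distrib, ← Finset.mul_sum]
          rw [hcomm]; ring
  rw [e1, integral_finsetSum _ fun i _ => integrable_finsetSum _ fun j _ => hint i j]
  refine Finset.sum_eq_zero fun i _ => ?_
  rw [integral_finsetSum _ fun j _ => hint i j]
  exact hV.sum_integral_divFree_mul_grad (hG' i) (hs' i) (fun j => (hG i j).2) (hdiv i)

/-- Equilibrated fields are orthogonal to compatible fields. -/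
lemma integral_inner_equilibrated_compatible (hV : IsUnitCell Y V) {s e : TensorField d}
    (hs : s ∈ equilibratedFields Y V) (he : e ∈ compatibleFields Y V) :
    ∫ x, ⟪s x, e x⟫_ℝ ∂cellMeasure V = 0 := by
  have := hV.isProbabilityMeasure
  obtain ⟨u, ⟨hu, n, hn⟩, s₀, hs₀, rfl⟩ := hs
  have mu := hV.memLp_of_mem hu
  have ms := hV.memLp_of_mem hs₀.1
  have me := hV.memLp_of_mem he.1
  have hn' : u =ᵐ[cellMeasure V] fun _ => n := hV.ae_cellMeasure_iff.2 (ae_restrict_of_ae hn)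
  simp_rw [Pi.add_apply, inner_add_left]
  rw [integral_add (integrable_inner_of_memLp mu me) (integrable_inner_of_memLp ms me)]
  -- A uniform field is divergence-free in the weak sense, again because derivatives of test
  -- functions average to zero.
  have e1 : ∫ x, ⟪u x, e x⟫_ℝ ∂cellMeasure V = 0 := by
    refine hV.integral_inner_compatible_of_divFree mu (fun i φ hφ => ?_) he
    have : ∫ x, ∑ j, entry i j (u x) * pderiv j φ x ∂cellMeasure V
        = ∫ x, ∑ j, entry i j n * pderiv j φ x ∂cellMeasure V := by
      refine integral_congr_ae ?_
      filter_upwards [hn'] with x hx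
      rw [hx]
    rw [this, integral_finsetSum]
    · simp [integral_const_mul, hV.integral_pderiv hφ]
    · intro j _
      exact ((hV.memLp_pderiv hφ j).integrable one_le_two).const_mul _
  have e2 : ∫ x, ⟪s₀ x, e x⟫_ℝ ∂cellMeasure V = 0 := by
    refine hV.integral_inner_compatible_of_divFree ms (fun i φ hφ => ?_) he
    have h := hs₀.2.1 i φ hφ
    rw [hV.setIntegral_eq_smul, smul_eq_zero_iff_right hV.volume_toReal_ne_zero] at h
    exact h
  rw [e1, e2, add_zero]

end IsUnitCell

/-- Three-term bound for a nonnegative quadratic form. -/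
lemma inner_apply_add_add_le {E : Type*} [NormedAddCommGroup E] [InnerProductSpace ℝ E]
    (B : E →L[ℝ] E) (hB : ∀ v, 0 ≤ ⟪v, B v⟫_ℝ) (a b c : E) :
    ⟪a + b + c, B (a + b + c)⟫_ℝ ≤ 3 * (⟪a, B a⟫_ℝ + ⟪b, B b⟫_ℝ + ⟪c, B c⟫_ℝ) := by
  -- The right side minus the left is the sum of the form at the three differences.
  have h1 := hB (a - b)
  have h2 := hB (b - c)
  have h3 := hB (a - c)
  simp only [map_add, map_sub, inner_add_left, inner_add_right, inner_sub_left,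
    inner_sub_right] at *
  linarith

/-! ### Pointwise algebra of the constitutive error -/

section Pointwise

variable {E : Type*} [NormedAddCommGroup E] [InnerProductSpace ℝ E] {A : E →L[ℝ] E}

/-- The error in the constitutive relation as a square. -/
lemma constitutiveError_eq (hinv : A.IsInvertible) (hsymm : ∀ e f, ⟪A e, f⟫_ℝ = ⟪e, A f⟫_ℝ)
    (t n : E) :
    1 / 2 * ⟪A n, n⟫_ℝ + 1 / 2 * ⟪t, A.inverse t⟫_ℝ - ⟪t, n⟫_ℝ
      = 1 / 2 * ⟪t - A n, A.inverse (t - A n)⟫_ℝ := by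
  have h : ⟪A n, A.inverse t⟫_ℝ = ⟪t, n⟫_ℝ := by
    rw [hsymm, hinv.self_apply_inverse, real_inner_comm]
  rw [map_sub, hinv.inverse_apply_self, inner_sub_left, inner_sub_right, inner_sub_right, h]
  ring

lemma inner_inverse_nonneg (hinv : A.IsInvertible) {α : ℝ} (hα : 0 < α)
    (hco : ∀ e, α * ‖e‖ ^ 2 ≤ ⟪A e, e⟫_ℝ) (v : E) : 0 ≤ ⟪v, A.inverse v⟫_ℝ := by
  have := hco (A.inverse v)
  rw [hinv.self_apply_inverse] at this
  exact (by positivity : (0 : ℝ) ≤ α * ‖A.inverse v‖ ^ 2).trans this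

/-- With `u = A⁻¹ v`, coercivity and Cauchy–Schwarz give `α ‖u‖² ≤ ‖v‖ ‖u‖`. -/
lemma norm_inverse_le (hinv : A.IsInvertible) {α : ℝ} (hα : 0 < α)
    (hco : ∀ e, α * ‖e‖ ^ 2 ≤ ⟪A e, e⟫_ℝ) (v : E) : ‖A.inverse v‖ ≤ α⁻¹ * ‖v‖ := by
  have h := hco (A.inverse v)
  rw [hinv.self_apply_inverse] at h
  have h2 := h.trans (real_inner_le_norm _ _)
  rcases (norm_nonneg (A.inverse v)).eq_or_lt with h0 | h0
  · rw [← h0]; positivity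
  · rw [le_inv_mul_iff₀ hα]
    refine le_of_mul_le_mul_right ?_ h0
    nlinarith

/-- Stability of the error in the constitutive relation. -/
lemma constitutiveError_sub_le (hinv : A.IsInvertible)
    (hsymm : ∀ e f, ⟪A e, f⟫_ℝ = ⟪e, A f⟫_ℝ) {α M : ℝ} (hα : 0 < α)
    (hco : ∀ e, α * ‖e‖ ^ 2 ≤ ⟪A e, e⟫_ℝ) (hM : ‖A‖ ≤ M) (t n b g : E) :
    1 / 2 * ⟪A (n - g), n - g⟫_ℝ + 1 / 2 * ⟪t - b, A.inverse (t - b)⟫_ℝ - ⟪t - b, n - g⟫_ℝ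
      ≤ 3 * ((1 / 2 * ⟪A n, n⟫_ℝ + 1 / 2 * ⟪t, A.inverse t⟫_ℝ - ⟪t, n⟫_ℝ)
        + α⁻¹ / 2 * ‖b‖ ^ 2 + M / 2 * ‖g‖ ^ 2) := by
  rw [constitutiveError_eq hinv hsymm, constitutiveError_eq hinv hsymm]
  -- The new residual is the old one, corrected by the static error `b` and by the kinematic error
  -- `g` seen through `A`.
  have e : t - b - A (n - g) = (t - A n) + -b + A g := by
    rw [map_sub]; abel
  have h := inner_apply_add_add_le A.inverse (inner_inverse_nonneg hinv hα hco) (t - A n) (-b) (A g)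
  have hb : ⟪-b, A.inverse (-b)⟫_ℝ ≤ α⁻¹ * ‖b‖ ^ 2 := by
    refine (real_inner_le_norm _ _).trans ?_
    have := norm_inverse_le hinv hα hco (-b)
    rw [norm_neg] at this ⊢
    nlinarith [norm_nonneg b]
  have hg : ⟪A g, A.inverse (A g)⟫_ℝ ≤ M * ‖g‖ ^ 2 := by
    rw [hinv.inverse_apply_self]
    refine (real_inner_le_norm _ _).trans ?_
    have := A.le_of_opNorm_le hM g
    nlinarith [norm_nonneg g]
  rw [e]
  linarith

end Pointwise

end

/-! ### Integrated error and the energy estimate -/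

section

variable {Y : Module.Basis (Fin d) ℝ (Space d)} {V : Set (Space d)} {A : Tensor4 d}

/-- A field of tensors with uniform bounds, for a measure `μ`. -/
structure UniformlyElastic (μ : Measure (Space d)) (L : Space d → Tensor4 d) (α M : ℝ) :
    Prop where
  aestronglyMeasurable : AEStronglyMeasurable L μ
  pos : 0 < α
  nonneg : 0 ≤ M
  bounded : ∀ᵐ x ∂μ, ‖L x‖ ≤ M
  major_symm : ∀ᵐ x ∂μ, ∀ e f : SymTensor d, ⟪L x e, f⟫_ℝ = ⟪e, L x f⟫_ℝ
  coercive : ∀ᵐ x ∂μ, ∀ e : SymTensor d, α * ‖e‖ ^ 2 ≤ ⟪L x e, e⟫_ℝ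

lemma isInvertible_of_coercive {α : ℝ} (hα : 0 < α)
    (h : ∀ e : SymTensor d, α * ‖e‖ ^ 2 ≤ ⟪A e, e⟫_ℝ) : A.IsInvertible :=
  isInvertible_of_pos fun e he => lt_of_lt_of_le
    (mul_pos hα (pow_pos (norm_pos_iff.2 he) 2)) (h e)

namespace UniformlyElastic

variable {μ : Measure (Space d)} {L : Space d → Tensor4 d} {α M : ℝ}

lemma memLp_apply (hL : UniformlyElastic μ L α M) {f : TensorField d} (hf : MemLp f 2 μ) :
    MemLp (fun x => L x (f x)) 2 μ :=
  PeriodicElasticity.memLp_apply hL.aestronglyMeasurable hL.bounded hf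

lemma memLp_inverse_apply (hL : UniformlyElastic μ L α M) {f : TensorField d} (hf : MemLp f 2 μ) :
    MemLp (fun x => (L x).inverse (f x)) 2 μ := by
  refine PeriodicElasticity.memLp_apply (M := α⁻¹) (L := fun x => (L x).inverse)
    (measurable_inverse.comp_aemeasurable
      hL.aestronglyMeasurable.aemeasurable).aestronglyMeasurable ?_ hf
  filter_upwards [hL.coercive] with x hx
  exact ContinuousLinearMap.opNorm_le_bound _ (inv_nonneg.2 hL.pos.le)
    (norm_inverse_le (isInvertible_of_coercive hL.pos hx) hL.pos hx)

lemma integrable_strain (hL : UniformlyElastic μ L α M) {f : TensorField d} (hf : MemLp f 2 μ) :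
    Integrable (fun x => ⟪L x (f x), f x⟫_ℝ) μ :=
  integrable_inner_of_memLp (hL.memLp_apply hf) hf

lemma integrable_stress (hL : UniformlyElastic μ L α M) {f : TensorField d} (hf : MemLp f 2 μ) :
    Integrable (fun x => ⟪f x, (L x).inverse (f x)⟫_ℝ) μ :=
  integrable_inner_of_memLp hf (hL.memLp_inverse_apply hf)

lemma integrable_constitutiveError (hL : UniformlyElastic μ L α M) {τ η : TensorField d}
    (hτ : MemLp τ 2 μ) (hη : MemLp η 2 μ) : Integrable (constitutiveError L τ η) μ :=
  (((hL.integrable_strain hη).const_mul _).add ((hL.integrable_stress hτ).const_mul _)).sub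
    (integrable_inner_of_memLp hτ hη)

lemma integral_constitutiveError (hL : UniformlyElastic μ L α M) {τ η : TensorField d}
    (hτ : MemLp τ 2 μ) (hη : MemLp η 2 μ) : ∫ x, constitutiveError L τ η x ∂μ
      = 1 / 2 * ∫ x, ⟪L x (η x), η x⟫_ℝ ∂μ + 1 / 2 * ∫ x, ⟪τ x, (L x).inverse (τ x)⟫_ℝ ∂μ
        - ∫ x, ⟪τ x, η x⟫_ℝ ∂μ := by
  refine (integral_sub (((hL.integrable_strain hη).const_mul _).add
    ((hL.integrable_stress hτ).const_mul _)) (integrable_inner_of_memLp hτ hη)).trans ?_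
  refine congrArg (· - _) ((integral_add ((hL.integrable_strain hη).const_mul _)
    ((hL.integrable_stress hτ).const_mul _)).trans ?_)
  simp only [integral_const_mul]

lemma constitutiveError_nonneg (hL : UniformlyElastic μ L α M) (τ η : TensorField d) :
    ∀ᵐ x ∂μ, 0 ≤ constitutiveError L τ η x := by
  filter_upwards [hL.major_symm, hL.coercive] with x h1 h2
  have hinv := isInvertible_of_coercive hL.pos h2
  unfold constitutiveError
  rw [constitutiveError_eq hinv h1]
  exact mul_nonneg (by norm_num) (inner_inverse_nonneg hinv hL.pos h2 _)

lemma integrable_norm_sq {f : TensorField d} (hf : MemLp f 2 μ) :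
    Integrable (fun x => ‖f x‖ ^ 2) μ := by
  simp_rw [← real_inner_self_eq_norm_sq]
  exact integrable_inner_of_memLp hf hf

lemma integral_constitutiveError_sub_le (hL : UniformlyElastic μ L α M) {τ η b g : TensorField d}
    (hτ : MemLp τ 2 μ) (hη : MemLp η 2 μ) (hb : MemLp b 2 μ) (hg : MemLp g 2 μ) :
    ∫ x, constitutiveError L (τ - b) (η - g) x ∂μ ≤ 3 * (∫ x, constitutiveError L τ η x ∂μ
      + α⁻¹ / 2 * ∫ x, ‖b x‖ ^ 2 ∂μ + M / 2 * ∫ x, ‖g x‖ ^ 2 ∂μ) := by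
  have i1 := hL.integrable_constitutiveError hτ hη
  have i2 := (integrable_norm_sq hb).const_mul (α⁻¹ / 2)
  have i3 := (integrable_norm_sq hg).const_mul (M / 2)
  have e : 3 * (∫ x, constitutiveError L τ η x ∂μ
      + α⁻¹ / 2 * ∫ x, ‖b x‖ ^ 2 ∂μ + M / 2 * ∫ x, ‖g x‖ ^ 2 ∂μ)
      = ∫ x, 3 * (constitutiveError L τ η x + α⁻¹ / 2 * ‖b x‖ ^ 2 + M / 2 * ‖g x‖ ^ 2) ∂μ := by
    rw [integral_const_mul]
    refine congrArg _ (Eq.symm ((integral_add (i1.add i2) i3).trans ?_))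
    refine (congrArg (· + _) (integral_add i1 i2)).trans ?_
    simp only [integral_const_mul]
  rw [e]
  refine integral_mono_ae (hL.integrable_constitutiveError (hτ.sub hb) (hη.sub hg))
    (((i1.add i2).add i3).const_mul 3) ?_
  filter_upwards [hL.major_symm, hL.coercive, hL.bounded] with x h1 h2 h3
  exact constitutiveError_sub_le (isInvertible_of_coercive hL.pos h2) h1 hL.pos h2 h3 _ _ _ _

end UniformlyElastic

namespace IsUnitCell

variable {L : Space d → Tensor4 d} {α M : ℝ}

lemma norm_sq_le_strainProd {β : ℝ} (hβ : ∀ e : SymTensor d, β * ‖e‖ ^ 2 ≤ ⟪A e, e⟫_ℝ)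
    {f : TensorField d} (hf : MemLp f 2 (cellMeasure V)) :
    β * ∫ x, ‖f x‖ ^ 2 ∂cellMeasure V ≤ strainProd V A f f := by
  rw [← integral_const_mul, strainProd_eq_integral]
  exact integral_mono ((UniformlyElastic.integrable_norm_sq hf).const_mul _)
    (integrable_strainProd A hf hf) fun x => hβ _

/-- For admissible fields the sum of the energies is the error in the constitutive relation. -/
lemma complementaryEnergy_add_strainEnergy (hV : IsUnitCell Y V)
    (hL : UniformlyElastic (cellMeasure V) L α M) (ε : SymTensor d) {s e : TensorField d}
    (hs : s ∈ equilibratedFields Y V) (he : e ∈ compatibleFields Y V) :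
    complementaryEnergy V L ε s + strainEnergy V L ε e
      = ∫ x, constitutiveError L s ((fun _ => ε) + e) x ∂cellMeasure V := by
  have ms := hV.memLp_of_mem (mem_tensorFields_of_mem_equilibratedFields hs)
  have me := hV.memLp_of_mem he.1
  have mc := hV.memLp_of_mem (hV.const_mem_tensorFields ε)
  rw [hL.integral_constitutiveError ms (mc.add me)]
  unfold complementaryEnergy strainEnergy
  simp only [setAverage_eq_integral_cellMeasure, Pi.add_apply, inner_add_right (s _)]
  -- The coupling term of the constitutive error reduces to the loading term of `J_c`, since `s`
  -- does no work on `e`.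
  have : ∫ x, (⟪s x, ε⟫_ℝ + ⟪s x, e x⟫_ℝ) ∂cellMeasure V
      = ⟪∫ x, s x ∂cellMeasure V, ε⟫_ℝ := by
    rw [integral_add (integrable_inner_of_memLp ms mc) (integrable_inner_of_memLp ms me),
      hV.integral_inner_equilibrated_compatible hs he, hV.integral_inner_const ms, add_zero]
  rw [this]
  ring

lemma energy_nonneg (hV : IsUnitCell Y V)
    (hL : UniformlyElastic (cellMeasure V) L α M) (ε : SymTensor d) {s e : TensorField d}
    (hs : s ∈ equilibratedFields Y V) (he : e ∈ compatibleFields Y V) :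
    0 ≤ complementaryEnergy V L ε s + strainEnergy V L ε e := by
  rw [hV.complementaryEnergy_add_strainEnergy hL ε hs he]
  exact integral_nonneg_of_ae (hL.constitutiveError_nonneg _ _)

/-- Stability of the constitutive error is applied to the defects `τ - τ_S` and `η - η_{E_0} - ε`;
`γ` and `β` convert their `L²` norms into energetic ones. -/
lemma energy_le (hV : IsUnitCell Y V) (hL : UniformlyElastic (cellMeasure V) L α M)
    (hA : IsElasticityTensor A) {β γ : ℝ} (hβ : 0 < β) (hγ : 0 < γ)
    (hβA : ∀ e : SymTensor d, β * ‖e‖ ^ 2 ≤ ⟪A e, e⟫_ℝ)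
    (hγA : ∀ e : SymTensor d, γ * ‖e‖ ^ 2 ≤ ⟪A.inverse e, e⟫_ℝ) (ε : SymTensor d)
    {τ η : TensorField d} (hτ : τ ∈ tensorFields Y V) (hη : η ∈ tensorFields Y V) :
    complementaryEnergy V L ε (statComponent Y V A τ) + strainEnergy V L ε (kinComponent Y V A η)
      ≤ 3 * (1 + α⁻¹ * γ⁻¹ + M * β⁻¹) * geometricFunctional Y V L A ε τ η := by
  have hs := (hV.isOrthProj_statComponent hA hτ).1
  have he := (hV.isOrthProj_kinComponent hA hη).1
  have hdec := hV.statOrthoComponent_ae_eq hA hτ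
  rw [hV.complementaryEnergy_add_strainEnergy hL ε hs he]
  unfold geometricFunctional compatError equilError
  rw [setAverage_eq_integral_cellMeasure, hA.stressProd_eq, strainProd_congr _ hdec hdec]
  set s := statComponent Y V A τ
  set e := kinComponent Y V A η
  have mτ := hV.memLp_of_mem hτ
  have mη := hV.memLp_of_mem hη
  have ms := hV.memLp_of_mem (mem_tensorFields_of_mem_equilibratedFields hs)
  have me := hV.memLp_of_mem he.1
  have mc := hV.memLp_of_mem (hV.const_mem_tensorFields ε)
  have mb := mτ.sub ms
  have mg := (mη.sub me).sub mc
  set b : TensorField d := τ - s with hb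
  set g : TensorField d := η - e - fun _ => ε with hg
  have h := hL.integral_constitutiveError_sub_le mτ mη mb mg
  rw [show τ - b = s by rw [hb, sub_sub_cancel],
    show η - g = (fun _ => ε) + e by rw [hg]; abel] at h
  have hr : 0 ≤ ∫ x, constitutiveError L τ η x ∂cellMeasure V :=
    integral_nonneg_of_ae (hL.constitutiveError_nonneg _ _)
  have hB := norm_sq_le_strainProd hγA mb
  have hG := norm_sq_le_strainProd hβA mg
  have hB0 : 0 ≤ ∫ x, ‖b x‖ ^ 2 ∂cellMeasure V := integral_nonneg fun x => sq_nonneg _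
  have hG0 : 0 ≤ ∫ x, ‖g x‖ ^ 2 ∂cellMeasure V := integral_nonneg fun x => sq_nonneg _
  rw [← le_inv_mul_iff₀ hγ] at hB
  rw [← le_inv_mul_iff₀ hβ] at hG
  have hα' : 0 ≤ α⁻¹ := inv_nonneg.2 hL.pos.le
  have hM := hL.nonneg
  have hB1 : 0 ≤ strainProd V A.inverse b b :=
    nonneg_of_mul_nonneg_right (hB0.trans hB) (inv_pos.2 hγ)
  have hG1 : 0 ≤ strainProd V A g g :=
    nonneg_of_mul_nonneg_right (hG0.trans hG) (inv_pos.2 hβ)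
  set R := ∫ x, constitutiveError L τ η x ∂cellMeasure V
  set P := strainProd V A.inverse b b
  set Q := strainProd V A g g
  have hp : 0 ≤ α⁻¹ * γ⁻¹ := mul_nonneg hα' (inv_pos.2 hγ).le
  have hq : 0 ≤ M * β⁻¹ := mul_nonneg hM (inv_pos.2 hβ).le
  calc _ ≤ _ := h
    _ ≤ 3 * (R + α⁻¹ / 2 * (γ⁻¹ * P) + M / 2 * (β⁻¹ * Q)) := by gcongr
    _ = 3 * (R + (α⁻¹ * γ⁻¹) * (1 / 2 * P) + (M * β⁻¹) * (1 / 2 * Q)) := by ring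
    -- All three errors are nonnegative, so each coefficient may be enlarged to the common one.
    _ ≤ 3 * ((1 + α⁻¹ * γ⁻¹ + M * β⁻¹) * (1 / 2 * Q + R + 1 / 2 * P)) := by
      refine mul_le_mul_of_nonneg_left ?_ (by norm_num)
      have t1 := mul_nonneg hp hr
      have t2 := mul_nonneg hq hr
      have t3 := mul_nonneg hp hG1
      have t4 := mul_nonneg hq hB1
      nlinarith
    _ = _ := by ring

end IsUnitCell

end

end

end PeriodicElasticity

open PeriodicElasticity in
theorem proposition3p5 {d : ℕ} (V : Set (Space d)) (L : Space d → Tensor4 d)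
    (hL : IsElasticityField V L) (L₀ : Tensor4 d) (hL₀ : IsElasticityTensor L₀) :
    ∃ c : ℝ, 0 < c ∧
      ∀ Y : Module.Basis (Fin d) ℝ (Space d), IsUnitCell Y V →
      ∀ ε : SymTensor d,
      ∀ τ ∈ tensorFields Y V, ∀ η ∈ tensorFields Y V,
        IsOrthProj (stressProd V L₀) (equilibratedFields Y V) τ (statComponent Y V L₀ τ) ∧
        IsOrthProj (stressProd V L₀) (equilibratedOrtho Y V L₀) τ (statOrthoComponent Y V L₀ τ) ∧
        IsOrthProj (strainProd V L₀) (compatibleFields Y V) η (kinComponent Y V L₀ η) ∧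
        0 ≤ complementaryEnergy V L ε (statComponent Y V L₀ τ)
            + strainEnergy V L ε (kinComponent Y V L₀ η) ∧
        complementaryEnergy V L ε (statComponent Y V L₀ τ)
            + strainEnergy V L ε (kinComponent Y V L₀ η)
          ≤ c * geometricFunctional Y V L L₀ ε τ η := by
  obtain ⟨M, hM⟩ := hL.bounded
  obtain ⟨α, hα, hco⟩ := hL.coercive
  obtain ⟨β, hβ, hβA⟩ := hL₀.exists_coercive
  obtain ⟨γ, hγ, hγA⟩ := hL₀.inverse.exists_coercive
  -- The constant is fixed before `V` is known to be a cell; on a null set the bound `M` could be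
  -- negative, hence `|M|`.
  refine ⟨3 * (1 + α⁻¹ * γ⁻¹ + |M| * β⁻¹), by positivity, fun Y hV ε τ hτ η hη => ?_⟩
  have hU : UniformlyElastic (cellMeasure V) L α |M| :=
    { aestronglyMeasurable := hL.aestronglyMeasurable.smul_measure _
      pos := hα
      nonneg := abs_nonneg M
      bounded := hV.ae_cellMeasure_iff.2 (hM.mono fun x hx => hx.trans (le_abs_self M))
      major_symm := hV.ae_cellMeasure_iff.2 hL.major_symm
      coercive := hV.ae_cellMeasure_iff.2 hco }
  have hs := hV.isOrthProj_statComponent hL₀ hτ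
  have he := hV.isOrthProj_kinComponent hL₀ hη
  exact ⟨hs, hV.isOrthProj_statOrthoComponent hL₀ hτ, he, hV.energy_nonneg hU ε hs.1 he.1,
    hV.energy_le hU hL₀ hβ hγ hβA hγA ε hτ hη⟩
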